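/- Let $a,b,d\in\mathbb R$ with $ad>0$ and $b/d<1$. Let $H=L^2(0,1)\oplus\mathbb R$ with inner product $((u,u_1),(v,v_1))_H=\int_0^1uv\,dx+\frac ad u_1v_1$. For $s=1,2$ let $H_s=\{(u,u_1)\in H^s(0,1)\oplus\mathbb R:\ u(1)=u_1,\ u(0)=0\}$, and let $\mathcal H=H_{-1}$ be the dual space of $H_1$ with respect to the pivot space $H$. On $H_2$ put $\mathcal A(u,u_1)=\bigl(u_{xx},\,-\frac da u_x(1)+\frac ba u_1\bigr)$. For $T>0$ consider the control system $$u_t=u_{xx}\ \text{in }(0,1)\times(0,T),\qquad u(0,t)=f(t),\qquad au_{xx}(1,t)+du_x(1,t)-bu(1,t)=0,\qquad U(0)=U_0, \tag{1}$$ with $U(t)=(u(\cdot,t),u(1,t))$, $U_0\in\mathcal H$ and control $f\in L^2(0,T)$. Its solution is understood by transposition: $U\in L^2(0,T;H)\cap C([0,T];\mathcal H)$ and $$\int_0^T(U(t),G(t))_H\,dt=(U_0,\Phi(0))_{\mathcal H,H_1}+\int_0^T\varphi_x(0,t)f(t)\,dt$$ for every $G\in L^2(0,T;H)$, where $\Phi=(\varphi,\varphi_1)\in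 L^2(0,T;H_2)\cap C([0,T];H_1)$ is the strong solution of $\Phi'+\mathcal A\Phi=-G$ on $(0,T)$, $\Phi(T)=0$. System (1) is called boundary null controllable in $\mathcal H$ in time $T$ if for every $U_0\in\mathcal H$ there is $f\in L^2(0,T)$ such that the corresponding solution satisfies $U(T)=0$ in $\mathcal H$. **Theorem.** The (real) eigenvalues of the Sturm–Liouville problem $$y''+\lambda y=0,\qquad y(0)=0,\qquad (a\lambda+b)y(1)=dy'(1)$$ form a strictly increasing sequence $\lambda_n=\mu_n^2$, $n=0,1,2,\dots$, with $\mu_n>0$, and $y_n(x)=\sin(\mu_nx)$ is an eigenfunction for $\lambda_n$. Put $Y_n=(y_n,y_n(1))$, $Z_n=Y_n/\|Y_n\|_H$ and, for $U_0\in\mathcal H$, $\eta_n=(U_0,Z_n)_{\mathcal H,H_1}$. Then every $U_0\in\mathcal H$ has the Fourier expansion $U_0=\sum_{n=0}^\infty\eta_nZ_n$, convergent in $\mathcal H$. Moreover, for every $T>0$, system (1) is boundary null controllable in $\mathcal H$ in time $T$ if and only if for every $U_0\in\mathcal H$ there is a function $\theta\in L^2(0,T)$ such that $$\int_0^T\theta(t)e^{-\lambda_nt}\,dt=-\frac{\eta_ne^{-\lambda_nT}\|Y_n\|_H}{\mu_n}\qquad\text{for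 all }n=0,1,2,\dots$$ -/

import Mathlib

open MeasureTheory Set Filter Topology

noncomputable section

namespace Wentzell

/-- Lebesgue measure on `Ω = (0, 1)`. -/
abbrev vol01 : Measure ℝ := volume.restrict (Ioo (0 : ℝ) 1)

/-- The real Hilbert space `L²(0, 1)`. -/
abbrev L2 : Type := Lp ℝ 2 vol01

/-- The measure `dν = dx ⊕ (a/d) δ₁` on `(0, 1]`. -/
def nu (a d : ℝ) : Measure ℝ := vol01 + ENNReal.ofReal (a / d) • Measure.dirac (1 : ℝ)

/-- The Hilbert space `H = L²(0,1) ⊕ ℝ`, with inner product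
`((u,u₁),(v,v₁))_H = ∫₀¹ u v dx + (a/d) u₁ v₁`, realised as `L²((0,1], dν)`: the pair `(u, u₁)` is
the function that equals `u` on `(0, 1)` and takes the value `u₁` at the atom `1`. -/
abbrev H (a d : ℝ) : Type := Lp ℝ 2 (nu a d)

instance (a d : ℝ) : IsFiniteMeasure (nu a d) := by
  unfold nu
  have : IsFiniteMeasure (ENNReal.ofReal (a / d) • Measure.dirac (1 : ℝ)) :=
    Measure.smul_finite _ ENNReal.ofReal_ne_top
  infer_instance

lemma ae_nu_of {a d : ℝ} {p : ℝ → Prop} (h : ∀ᵐ x ∂vol01, p x) (h1 : p 1) :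
    ∀ᵐ x ∂(nu a d), p x := by
  unfold nu
  rw [ae_add_measure_iff]
  refine ⟨h, Measure.ae_smul_measure ?_ _⟩
  rw [ae_dirac_eq]
  exact h1

lemma ae_mem_Ioc (a d : ℝ) : ∀ᵐ x ∂(nu a d), x ∈ Ioc (0 : ℝ) 1 := by
  refine ae_nu_of ?_ (by simp)
  filter_upwards [ae_restrict_mem (measurableSet_Ioo (a := (0 : ℝ)) (b := 1))] with x hx
  exact ⟨hx.1, hx.2.le⟩

lemma update_ae_eq (w : ℝ → ℝ) (r : ℝ) : Function.update w 1 r =ᵐ[vol01] w := by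
  filter_upwards [ae_restrict_mem (measurableSet_Ioo (a := (0 : ℝ)) (b := 1))] with x hx
  exact Function.update_of_ne hx.2.ne _ _

lemma memLp_update (a d : ℝ) (w : L2) (r : ℝ) :
    MemLp (Function.update (w : ℝ → ℝ) 1 r) 2 (nu a d) := by
  have hw : MemLp (Function.update (w : ℝ → ℝ) 1 r) 2 vol01 :=
    (memLp_congr_ae (update_ae_eq _ r)).2 (Lp.memLp w)
  have hd : MemLp (Function.update (w : ℝ → ℝ) 1 r) 2
      (ENNReal.ofReal (a / d) • Measure.dirac (1 : ℝ)) := by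
    refine MemLp.smul_measure ?_ ENNReal.ofReal_ne_top
    have : Function.update (w : ℝ → ℝ) 1 r =ᵐ[Measure.dirac (1 : ℝ)] fun _ => r := by
      rw [Filter.EventuallyEq, ae_dirac_eq]; simp
    exact (memLp_congr_ae this).2 (memLp_const r)
  unfold nu
  have hm := hw.aestronglyMeasurable.add_measure hd.aestronglyMeasurable
  rw [memLp_two_iff_integrable_sq hm]
  exact ((memLp_two_iff_integrable_sq hw.aestronglyMeasurable).1 hw).add_measure
    ((memLp_two_iff_integrable_sq hd.aestronglyMeasurable).1 hd)

/-- The element `(w, r)` of `H = L²(0,1) ⊕ ℝ`. -/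
def pair (a d : ℝ) (w : L2) (r : ℝ) : H a d := (memLp_update a d w r).toLp _

lemma intervalIntegrable_L2 (g : L2) {x : ℝ} (hx : x ∈ Icc (0 : ℝ) 1) :
    IntervalIntegrable (g : ℝ → ℝ) volume 0 x := by
  have h1 : IntegrableOn (g : ℝ → ℝ) (Ioo (0 : ℝ) 1) volume :=
    (Lp.memLp g).integrable (by norm_num)
  have h2 : IntegrableOn (g : ℝ → ℝ) (Ioc (0 : ℝ) 1) volume :=
    (integrableOn_Ioc_iff_integrableOn_Ioo (by simp)).2 h1
  rw [intervalIntegrable_iff_integrableOn_Ioc_of_le hx.1]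
  exact h2.mono_set (Ioc_subset_Ioc_right hx.2)

lemma integral_congr_L2 {g h : ℝ → ℝ} (e : g =ᵐ[vol01] h) {x : ℝ} (hx : x ∈ Icc (0 : ℝ) 1) :
    ∫ s in (0 : ℝ)..x, g s = ∫ s in (0 : ℝ)..x, h s := by
  rw [intervalIntegral.integral_of_le hx.1, intervalIntegral.integral_of_le hx.1,
    integral_Ioc_eq_integral_Ioo, integral_Ioc_eq_integral_Ioo]
  exact integral_congr_ae (ae_restrict_of_ae_restrict_of_subset (Ioo_subset_Ioo_right hx.2) e)

lemma integral_add_L2 (g h : L2) {x : ℝ} (hx : x ∈ Icc (0 : ℝ) 1) :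
    ∫ s in (0 : ℝ)..x, (g + h : L2) s = (∫ s in (0 : ℝ)..x, g s) + ∫ s in (0 : ℝ)..x, h s := by
  rw [integral_congr_L2 (Lp.coeFn_add g h) hx]
  exact intervalIntegral.integral_add (intervalIntegrable_L2 g hx) (intervalIntegrable_L2 h hx)

lemma integral_smul_L2 (c : ℝ) (g : L2) {x : ℝ} (hx : x ∈ Icc (0 : ℝ) 1) :
    ∫ s in (0 : ℝ)..x, (c • g : L2) s = c * ∫ s in (0 : ℝ)..x, g s := by
  rw [integral_congr_L2 (Lp.coeFn_smul c g) hx]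
  simp

lemma integral_zero_L2 {x : ℝ} (hx : x ∈ Icc (0 : ℝ) 1) :
    ∫ s in (0 : ℝ)..x, (0 : L2) s = 0 := by
  rw [integral_congr_L2 (Lp.coeFn_zero ℝ 2 vol01) hx]
  simp

/-- The space `H₁ = {(u,u₁) ∈ H¹(0,1) ⊕ ℝ : u(1) = u₁, u(0) = 0}`. Its elements are stored as
pairs `((u,u₁), u_x) ∈ H × L²(0,1)`; the condition `u(x) = ∫₀ˣ u_x` for `ν`-almost every
`x ∈ (0, 1]` says that `u` is in `H¹(0,1)` with weak derivative `u_x` and `u(0) = 0`, and, through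
the atom of `ν`, that `u₁ = ∫₀¹ u_x = u(1)`. The norm is the graph norm, equivalent to that of
`H¹(0,1) ⊕ ℝ`. -/
def H1 (a d : ℝ) : Submodule ℝ (H a d × L2) where
  carrier := {p | (p.1 : ℝ → ℝ) =ᵐ[nu a d] fun x => ∫ s in (0 : ℝ)..x, p.2 s}
  zero_mem' := by
    change ((0 : H a d) : ℝ → ℝ) =ᵐ[nu a d] fun x => ∫ s in (0 : ℝ)..x, (0 : L2) s
    filter_upwards [Lp.coeFn_zero ℝ 2 (nu a d), ae_mem_Ioc a d] with x h1 hx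
    rw [h1, integral_zero_L2 (Ioc_subset_Icc_self hx)]; rfl
  add_mem' := by
    intro p q hp hq
    change ((p.1 + q.1 : H a d) : ℝ → ℝ) =ᵐ[nu a d] fun x => ∫ s in (0 : ℝ)..x, (p.2 + q.2 : L2) s
    rw [mem_ofPred_eq] at hp hq
    filter_upwards [Lp.coeFn_add p.1 q.1, ae_mem_Ioc a d, hp, hq] with x h1 hx h2 h3
    rw [h1, integral_add_L2 p.2 q.2 (Ioc_subset_Icc_self hx), Pi.add_apply, h2, h3]
  smul_mem' := by
    intro c p hp
    change ((c • p.1 : H a d) : ℝ → ℝ) =ᵐ[nu a d] fun x => ∫ s in (0 : ℝ)..x, (c • p.2 : L2) s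
    rw [mem_ofPred_eq] at hp
    filter_upwards [Lp.coeFn_smul c p.1, ae_mem_Ioc a d, hp] with x h1 hx h2
    rw [h1, integral_smul_L2 c p.2 (Ioc_subset_Icc_self hx), Pi.smul_apply, h2, smul_eq_mul]

/-- The embedding `H₁ → H`. -/
def toH (a d : ℝ) : H1 a d →L[ℝ] H a d :=
  (ContinuousLinearMap.fst ℝ (H a d) L2).comp (H1 a d).subtypeL

/-- The state space `𝓗 = H₋₁`, the dual of `H₁` with pivot space `H`. For `F : Hminus1 a d` and
`Φ : H1 a d`, the duality bracket `(F, Φ)_{𝓗, H₁}` is `F Φ`. -/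
abbrev Hminus1 (a d : ℝ) : Type := StrongDual ℝ (H1 a d)

/-- The embedding `H → 𝓗` given by the pivot space: `(V, Φ)_{𝓗, H₁} = (V, Φ)_H`. -/
def pivot (a d : ℝ) (V : H a d) : Hminus1 a d := (innerSL ℝ V).comp (toH a d)

/-- The space `H₂ = {(u,u₁) ∈ H²(0,1) ⊕ ℝ : u(1) = u₁, u(0) = 0}`. Its elements are stored as
triples `(Φ, u_xx, u_x(0)) ∈ H₁ × L²(0,1) × ℝ` with `Φ = (u,u₁)`, subject to
`u_x(x) = u_x(0) + ∫₀ˣ u_xx`. The norm is equivalent to that of `H²(0,1) ⊕ ℝ`. -/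
def H2 (a d : ℝ) : Submodule ℝ (H1 a d × L2 × ℝ) where
  carrier := {p | ((p.1 : H a d × L2).2 : ℝ → ℝ) =ᵐ[vol01]
    fun x => p.2.2 + ∫ s in (0 : ℝ)..x, p.2.1 s}
  zero_mem' := by
    change ((0 : L2) : ℝ → ℝ) =ᵐ[vol01] fun x => 0 + ∫ s in (0 : ℝ)..x, (0 : L2) s
    filter_upwards [Lp.coeFn_zero ℝ 2 vol01, ae_restrict_mem measurableSet_Ioo] with x h1 hx
    rw [h1, integral_zero_L2 (Ioo_subset_Icc_self hx), add_zero]; rfl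
  add_mem' := by
    intro p q hp hq
    change (((p.1 : H a d × L2).2 + (q.1 : H a d × L2).2 : L2) : ℝ → ℝ) =ᵐ[vol01]
      fun x => (p.2.2 + q.2.2) + ∫ s in (0 : ℝ)..x, (p.2.1 + q.2.1 : L2) s
    rw [mem_ofPred_eq] at hp hq
    filter_upwards [Lp.coeFn_add (p.1 : H a d × L2).2 (q.1 : H a d × L2).2,
      ae_restrict_mem measurableSet_Ioo, hp, hq] with x h1 hx h2 h3
    rw [h1, integral_add_L2 p.2.1 q.2.1 (Ioo_subset_Icc_self hx), Pi.add_apply, h2, h3]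
    ring
  smul_mem' := by
    intro c p hp
    change ((c • (p.1 : H a d × L2).2 : L2) : ℝ → ℝ) =ᵐ[vol01]
      fun x => c * p.2.2 + ∫ s in (0 : ℝ)..x, (c • p.2.1 : L2) s
    rw [mem_ofPred_eq] at hp
    filter_upwards [Lp.coeFn_smul c (p.1 : H a d × L2).2,
      ae_restrict_mem measurableSet_Ioo, hp] with x h1 hx h2
    rw [h1, integral_smul_L2 c p.2.1 (Ioo_subset_Icc_self hx), Pi.smul_apply, h2, smul_eq_mul]
    ring

/-- The embedding `H₂ → H₁`. -/
def toH1 {a d : ℝ} (p : H2 a d) : H1 a d := (p : H1 a d × L2 × ℝ).1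

/-- The second derivative `u_xx ∈ L²(0,1)` of `(u,u₁) ∈ H₂`. -/
def dxx {a d : ℝ} (p : H2 a d) : L2 := (p : H1 a d × L2 × ℝ).2.1

/-- The trace `u_x(0)` of `(u,u₁) ∈ H₂`. -/
def dx0 {a d : ℝ} (p : H2 a d) : ℝ := (p : H1 a d × L2 × ℝ).2.2

/-- The trace `u_x(1)` of `(u,u₁) ∈ H₂`. -/
def dx1 {a d : ℝ} (p : H2 a d) : ℝ := dx0 p + ∫ s in (0 : ℝ)..1, dxx p s

/-- The operator `𝓐(u,u₁) = (u_xx, -(d/a) u_x(1) + (b/a) u₁)` with domain `H₂`. -/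
def opA (a b d : ℝ) (p : H2 a d) : H a d :=
  pair a d (dxx p) (-(d / a) * dx1 p + (b / a) * toH a d (toH1 p) 1)

/-- Lebesgue measure on `(0, T)`. -/
abbrev volT (T : ℝ) : Measure ℝ := volume.restrict (Ioo (0 : ℝ) T)

/-- `Φ ∈ L²(0,T;H₂) ∩ C([0,T];H₁)` is the strong solution of the backward system
`Φ' + 𝓐 Φ = -G` in `H` on `(0,T)`, `Φ(T) = 0`, in other words of
`φ_t + φ_xx = -g` in `(0,1) × (0,T)`, `-a φ₁' + d φ_x(1,t) - b φ₁ = a g₁`, `φ(0,t) = 0`,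
`φ₁(t) = φ(1,t)`, `Φ(T) = 0`, where `G = (g,g₁)`. The function `Ψ` is `Φ` regarded as an element
of `L²(0,T;H₂)`. -/
structure IsBackwardSolution (a b d T : ℝ) (G : ℝ → H a d) (Φ : ℝ → H1 a d) (Ψ : ℝ → H2 a d) :
    Prop where
  continuousOn : ContinuousOn Φ (Icc 0 T)
  memLp : MemLp Ψ 2 (volT T)
  ae_eq : ∀ᵐ t ∂(volT T), toH1 (Ψ t) = Φ t
  equation : ∀ t ∈ Icc 0 T, toH a d (Φ t) = ∫ s in t..T, (opA a b d (Ψ s) + G s)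

/-- `U ∈ L²(0,T;H) ∩ C([0,T];𝓗)` is the solution by transposition, with initial datum `U₀ ∈ 𝓗` and
control `f`, of `u_t = u_xx`, `u(0,t) = f(t)`, `a u_xx(1,t) + d u_x(1,t) - b u(1,t) = 0`,
`U(0) = U₀`. The function `V` is `U` regarded as an element of `L²(0,T;H)`. -/
def IsTranspositionSolution (a b d T : ℝ) (U₀ : Hminus1 a d) (f : ℝ → ℝ)
    (U : ℝ → Hminus1 a d) : Prop :=
  ContinuousOn U (Icc 0 T) ∧
  ∃ V : ℝ → H a d, MemLp V 2 (volT T) ∧ (∀ᵐ t ∂(volT T), U t = pivot a d (V t)) ∧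
    ∀ (G : ℝ → H a d) (Φ : ℝ → H1 a d) (Ψ : ℝ → H2 a d), MemLp G 2 (volT T) →
      IsBackwardSolution a b d T G Φ Ψ →
      ∫ t in (0 : ℝ)..T, inner ℝ (V t) (G t) = U₀ (Φ 0) + ∫ t in (0 : ℝ)..T, dx0 (Ψ t) * f t

/-- Boundary null controllability in `𝓗` in time `T`: every initial datum in `𝓗` is driven to zero
by some control in `L²(0,T)`. -/
def NullControllable (a b d T : ℝ) : Prop :=
  ∀ U₀ : Hminus1 a d, ∃ f : ℝ → ℝ, MemLp f 2 (volT T) ∧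
    ∃ U : ℝ → Hminus1 a d, IsTranspositionSolution a b d T U₀ f U ∧ U T = 0

/-- `y` is an eigenfunction, for the eigenvalue `lam`, of the Sturm-Liouville problem
`y'' + lam y = 0` on `[0, 1]`, `y(0) = 0`, `(a lam + b) y(1) = d y'(1)`. -/
def IsEigenfunction (a b d lam : ℝ) (y : ℝ → ℝ) : Prop :=
  (∃ x ∈ Icc (0 : ℝ) 1, y x ≠ 0) ∧ y 0 = 0 ∧
  ∃ y' : ℝ → ℝ,
    (∀ x ∈ Icc (0 : ℝ) 1, HasDerivWithinAt y (y' x) (Icc 0 1) x) ∧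
    (∀ x ∈ Icc (0 : ℝ) 1, HasDerivWithinAt y' (-(lam * y x)) (Icc 0 1) x) ∧
    (a * lam + b) * y 1 = d * y' 1

/-- `lam` is an eigenvalue of the Sturm-Liouville problem. -/
def IsEigenvalue (a b d lam : ℝ) : Prop := ∃ y : ℝ → ℝ, IsEigenfunction a b d lam y

lemma memLp_of_continuous {μ : Measure ℝ} [IsFiniteMeasure μ] {w : ℝ → ℝ} (hw : Continuous w)
    (hb : ∃ C, ∀ x, |w x| ≤ C) : MemLp w 2 μ := by
  obtain ⟨C, hC⟩ := hb
  exact MemLp.of_bound hw.aestronglyMeasurable C (Eventually.of_forall hC)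

lemma memLp_sin (m : ℝ) (μ : Measure ℝ) [IsFiniteMeasure μ] :
    MemLp (fun x : ℝ => Real.sin (m * x)) 2 μ :=
  memLp_of_continuous (by fun_prop) ⟨1, fun x => Real.abs_sin_le_one _⟩

lemma memLp_cos (m : ℝ) (μ : Measure ℝ) [IsFiniteMeasure μ] :
    MemLp (fun x : ℝ => m * Real.cos (m * x)) 2 μ :=
  (memLp_of_continuous (w := fun x : ℝ => Real.cos (m * x)) (by fun_prop)
    ⟨1, fun x => Real.abs_cos_le_one _⟩).const_mul m

/-- `Y = (y, y(1)) ∈ H₁` with `y(x) = sin (m x)`. -/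
def Y (a d m : ℝ) : H1 a d :=
  ⟨((memLp_sin m (nu a d)).toLp _, (memLp_cos m vol01).toLp _), by
    change _ =ᵐ[nu a d] _
    filter_upwards [(memLp_sin m (nu a d)).coeFn_toLp, ae_mem_Ioc a d] with x h1 hx
    rw [h1, integral_congr_L2 (memLp_cos m vol01).coeFn_toLp (Ioc_subset_Icc_self hx),
      intervalIntegral.integral_eq_sub_of_hasDerivAt (f := fun x => Real.sin (m * x))]
    · simp
    · intro s _
      have h : HasDerivAt (fun x : ℝ => m * x) m s := by
        simpa using (hasDerivAt_id s).const_mul m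
      simpa [mul_comm] using h.sin
    · exact (by fun_prop : Continuous fun x : ℝ => m * Real.cos (m * x)).intervalIntegrable _ _⟩

/-- `‖Y‖_H`. -/
def normY (a d m : ℝ) : ℝ := ‖toH a d (Y a d m)‖

/-- The normalised element `Z = Y / ‖Y‖_H ∈ H₁`. -/
def Z (a d m : ℝ) : H1 a d := (normY a d m)⁻¹ • Y a d m

end Wentzell

end

/-!
Integration by parts shows that `-𝓐` is the operator in `H` of the form `∫₀¹ u_x v_x - (b/d)
u(1) v(1)` on `H₁`. The form is coercive since `u(1)² ≤ ∫₀¹ u_x²` and `b/d < 1`. Hence there is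
an isomorphism `energyE : H₁ ≃ L²(0,1)` that carries the form to the inner product of `L²(0,1)`.
In these coordinates the embedding of `H₁` into `H` is a compact operator `ι`
(`isCompactOperator_toH`), and the eigenvectors of `ι* ι` are the weak eigenfunctions, which are
multiples of `sin (m x)` by `eq_smul_Y_of_weak`. The spectral theorem makes `Z_n / μ_n` a
Hilbert basis of `L²(0,1)` (`exists_energyBasis`); the Riesz isomorphism turns this into the
Fourier expansion in `𝓗` (`hasSum_expansion`), and then `Z_n` is a Hilbert basis of `H`
(`exists_basis`).

The second tool is the Dirichlet lift `h` of the boundary value `1`, that is `h'' = 0`, `h(0) =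
1`, `d h'(1) = b h(1)`. It satisfies `(h, Z_n)_H = κ_n / λ_n`, where `κ_n = μ_n / ‖Y_n‖_H` is
the derivative of `Z_n` at `0` (`inner_lift_Z`), and `(𝓐 Ψ, h)_H = -Ψ_x(0)` (`inner_opA_lift`).
Bessel's inequality for `h` replaces eigenvalue asymptotics: it shows that there are finitely
many eigenvalues below each bound (`finite_isFreq_le`) and that `∑ (κ_n / λ_n)²` converges.

For the control system, testing the transposition identity with `G = g Z_n` gives `(U(T), Z_n) =
c_n(T)`, where `c_n' = -λ_n c_n + κ_n f` and `c_n(0) = η_n` (`IsTranspositionSolution.apply_Z`).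
Conversely the energy estimate for this scalar equation (`duhamel_energy`) bounds `sup c_n² /
λ_n` and `∫ c_n²` by `η_n² / λ_n + (κ_n / λ_n)² ‖f‖²`, which is summable, so that `∑ c_n Z_n`
converges to a solution for any `U₀` and `f` (`exists_isTranspositionSolution`). Therefore `U(T)
= 0` means that `c_n(T) = 0` for all `n`, and this is the moment problem for `θ(t) = f(T - t)`.
-/

noncomputable section

namespace Wentzell

/-! ### Absolutely continuous functions and scalar linear equations -/

/-- `F` is absolutely continuous on `[0, x]` with integrable derivative `p`, in integrated form. -/
structure IsPrimitive (F p : ℝ → ℝ) (x : ℝ) : Prop where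
  integrable : IntervalIntegrable p volume 0 x
  eq : ∀ t ∈ Icc 0 x, F t = F 0 + ∫ s in (0 : ℝ)..t, p s

namespace IsPrimitive

variable {F G p q : ℝ → ℝ} {x : ℝ}

lemma mono (hF : IsPrimitive F p x) {y : ℝ} (hy : y ∈ Icc 0 x) : IsPrimitive F p y where
  integrable := hF.integrable.mono_set (by
    rw [uIcc_of_le hy.1, uIcc_of_le (hy.1.trans hy.2)]; exact Icc_subset_Icc_right hy.2)
  eq t ht := hF.eq t ⟨ht.1, ht.2.trans hy.2⟩

lemma sub_eq (hF : IsPrimitive F p x) (hx : 0 ≤ x) : ∫ s in (0 : ℝ)..x, p s = F x - F 0 := by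
  have := hF.eq x ⟨hx, le_rfl⟩
  linarith

lemma continuousOn (hF : IsPrimitive F p x) (hx : 0 ≤ x) : ContinuousOn F (Icc 0 x) := by
  have h : ContinuousOn (fun t => F 0 + ∫ s in (0 : ℝ)..t, p s) (Icc 0 x) := by
    have := intervalIntegral.continuousOn_primitive_interval' hF.integrable
      (left_mem_uIcc (a := (0 : ℝ)) (b := x))
    rw [uIcc_of_le hx] at this
    exact continuousOn_const.add this
  exact h.congr hF.eq

lemma congr {F' p' : ℝ → ℝ} (hF : IsPrimitive F p x) (hx : 0 ≤ x) (h : ∀ t ∈ Icc 0 x, F' t = F t)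
    (h' : ∀ᵐ t ∂(volume.restrict (Ioc 0 x)), p' t = p t) : IsPrimitive F' p' x where
  integrable := by
    refine hF.integrable.congr_ae ?_
    rw [uIoc_of_le hx]
    filter_upwards [h'] with t ht using ht.symm
  eq t ht := by
    rw [h t ht, hF.eq t ht, h 0 ⟨le_rfl, hx⟩]
    congr 1
    rw [intervalIntegral.integral_of_le ht.1, intervalIntegral.integral_of_le ht.1]
    refine integral_congr_ae ?_
    filter_upwards [ae_restrict_of_ae_restrict_of_subset (Ioc_subset_Ioc_right ht.2) h'] with s hs
      using hs.symm

lemma of_hasDerivAt {F p : ℝ → ℝ} (h : ∀ t, HasDerivAt F (p t) t) (hp : Continuous p) (x : ℝ) :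
    IsPrimitive F p x where
  integrable := hp.intervalIntegrable _ _
  eq t _ := by
    rw [intervalIntegral.integral_eq_sub_of_hasDerivAt (fun s _ => h s) (hp.intervalIntegrable _ _)]
    ring

/-- Integration by parts for absolutely continuous functions. -/
lemma mul (hF : IsPrimitive F p x) (hG : IsPrimitive G q x) (hx : 0 ≤ x) :
    IsPrimitive (fun t => F t * G t) (fun t => p t * G t + F t * q t) x where
  integrable := by
    refine (hF.integrable.mul_continuousOn ?_).add (hG.integrable.continuousOn_mul ?_)
    · rw [uIcc_of_le hx]; exact hG.continuousOn hx
    · rw [uIcc_of_le hx]; exact hF.continuousOn hx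
  eq t ht := by
    replace hF := hF.mono ht
    replace hG := hG.mono ht
    have key : ∀ {F p : ℝ → ℝ}, IsPrimitive F p t →
        AbsolutelyContinuousOnInterval (fun y => F 0 + ∫ s in (0 : ℝ)..y, p s) 0 t ∧
        ∀ᵐ s, s ∈ uIcc 0 t → deriv (fun y => F 0 + ∫ s in (0 : ℝ)..y, p s) s = p s := by
      intro F p h
      refine ⟨?_, ?_⟩
      · have h1 := h.integrable.absolutelyContinuousOnInterval_intervalIntegral
          (c := 0) (by simp)
        have h2 : AbsolutelyContinuousOnInterval (fun _ : ℝ => F 0) 0 t :=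
          (LipschitzWith.const (F 0)).lipschitzOnWith.absolutelyContinuousOnInterval
        exact h2.fun_add h1
      · filter_upwards [h.integrable.ae_hasDerivAt_integral] with s hs hs'
        exact ((hs hs' 0 (by simp)).const_add _).deriv
    obtain ⟨a1, d1⟩ := key hF
    obtain ⟨a2, d2⟩ := key hG
    have e := a1.integral_deriv_mul_eq_sub a2
    rw [← hF.eq t ⟨ht.1, le_rfl⟩, ← hG.eq t ⟨ht.1, le_rfl⟩] at e
    simp only [intervalIntegral.integral_same, add_zero] at e
    rw [← sub_eq_iff_eq_add', ← e]
    refine intervalIntegral.integral_congr_ae ?_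
    filter_upwards [d1, d2] with s h1 h2 hs
    have hs' := uIoc_subset_uIcc hs
    have hs2 : s ∈ Icc 0 t := by rwa [uIcc_of_le ht.1] at hs'
    rw [h1 hs', h2 hs', hF.eq s hs2, hG.eq s hs2]

end IsPrimitive

/-- Variation of constants: the solution of `c' = -l c + k f`, `c(0) = η`. -/
def duhamel (l k η : ℝ) (f : ℝ → ℝ) (t : ℝ) : ℝ :=
  Real.exp (-l * t) * (η + k * ∫ s in (0 : ℝ)..t, Real.exp (l * s) * f s)

section duhamel

variable {l k η T : ℝ} {f : ℝ → ℝ}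

lemma duhamel_zero : duhamel l k η f 0 = η := by simp [duhamel]

lemma duhamel_eq_zero_iff :
    duhamel l k η f T = 0 ↔ k * ∫ s in (0 : ℝ)..T, Real.exp (l * s) * f s = -η := by
  rw [duhamel, mul_eq_zero, or_iff_right (Real.exp_pos _).ne', add_comm, add_eq_zero_iff_eq_neg]

lemma hasDerivAt_exp_mul (l t : ℝ) :
    HasDerivAt (fun t : ℝ => Real.exp (l * t)) (l * Real.exp (l * t)) t := by
  have h : HasDerivAt (fun x : ℝ => l * x) l t := by simpa using (hasDerivAt_id t).const_mul l
  simpa [mul_comm] using h.exp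

lemma isPrimitive_exp (l x : ℝ) :
    IsPrimitive (fun t => Real.exp (l * t)) (fun t => l * Real.exp (l * t)) x :=
  IsPrimitive.of_hasDerivAt (hasDerivAt_exp_mul l) (by fun_prop) x

lemma isPrimitive_duhamel (hT : 0 ≤ T) (hf : IntervalIntegrable f volume 0 T) :
    IsPrimitive (duhamel l k η f) (fun t => -l * duhamel l k η f t + k * f t) T := by
  have h1 : IsPrimitive (fun t => η + k * ∫ s in (0 : ℝ)..t, Real.exp (l * s) * f s)
      (fun t => k * (Real.exp (l * t) * f t)) T := by
    refine ⟨(hf.continuousOn_mul (by fun_prop)).const_mul k, fun t _ => ?_⟩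
    rw [intervalIntegral.integral_const_mul]; simp
  refine ((isPrimitive_exp (-l) T).mul h1 hT).congr hT (fun t _ => rfl) (.of_forall fun t => ?_)
  have : Real.exp (-l * t) * Real.exp (l * t) = 1 := by rw [← Real.exp_add]; simp
  simp only [duhamel]
  linear_combination (-k * f t) * this

/-- Energy estimate for `c' = -l c + k f`, from multiplying the equation by `c`. -/
lemma duhamel_energy (hl : 0 < l) (hT : 0 ≤ T) (hf : IntervalIntegrable f volume 0 T)
    (hf2 : IntervalIntegrable (fun s => f s ^ 2) volume 0 T) :
    duhamel l k η f T ^ 2 + l * ∫ t in (0 : ℝ)..T, duhamel l k η f t ^ 2 ≤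
      η ^ 2 + k ^ 2 / l * ∫ t in (0 : ℝ)..T, f t ^ 2 := by
  set c := duhamel l k η f with hc
  have hp : IsPrimitive c (fun t => -l * c t + k * f t) T := isPrimitive_duhamel hT hf
  have hcc := hp.continuousOn hT
  have hcu : ContinuousOn c (uIcc 0 T) := by rwa [uIcc_of_le hT]
  have h2 := (hp.mul hp hT)
  have e := h2.sub_eq hT
  have hci : IntervalIntegrable (fun t => c t ^ 2) volume 0 T := (hcu.pow 2).intervalIntegrable
  have hle : ∫ s in (0 : ℝ)..T, ((-l * c s + k * f s) * c s + c s * (-l * c s + k * f s)) ≤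
      ∫ s in (0 : ℝ)..T, (-l * c s ^ 2 + k ^ 2 / l * f s ^ 2) := by
    refine intervalIntegral.integral_mono_on hT h2.integrable
      ((hci.const_mul _).add (hf2.const_mul _)) fun s _ => ?_
    have h3 : k ^ 2 / l * f s ^ 2 = l * (k * f s / l) ^ 2 := by field_simp
    have h4 : k * f s * c s = l * (k * f s / l) * c s := by field_simp
    rw [h3]
    -- Young's inequality: the difference of the two sides is `l (c - k f / l)²`.
    nlinarith [mul_nonneg hl.le (sq_nonneg (c s - k * f s / l))]
  rw [e, intervalIntegral.integral_add (hci.const_mul _) (hf2.const_mul _),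
    intervalIntegral.integral_const_mul, intervalIntegral.integral_const_mul] at hle
  have h0 : c 0 = η := duhamel_zero
  rw [h0] at hle
  nlinarith

/-- Duality between the forward equation `c' = -l c + k f` and the backward equation
`φ' = l φ - g`, `φ(T) = 0`. -/
lemma duhamel_duality {φ g : ℝ → ℝ} (hT : 0 ≤ T) (hf : IntervalIntegrable f volume 0 T)
    (hg : IntervalIntegrable g volume 0 T)
    (hφ : IsPrimitive φ (fun t => l * φ t - g t) T) (hφT : φ T = 0) :
    ∫ t in (0 : ℝ)..T, duhamel l k η f t * g t = η * φ 0 + k * ∫ t in (0 : ℝ)..T, φ t * f t := by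
  set c := duhamel l k η f with hc
  have hp : IsPrimitive c (fun t => -l * c t + k * f t) T := isPrimitive_duhamel hT hf
  have e := (hp.mul hφ hT).sub_eq hT
  have hcu : ContinuousOn c (uIcc 0 T) := by rw [uIcc_of_le hT]; exact hp.continuousOn hT
  have hφu : ContinuousOn φ (uIcc 0 T) := by rw [uIcc_of_le hT]; exact hφ.continuousOn hT
  have h0 : c 0 = η := duhamel_zero
  rw [hφT, h0] at e
  have h1 : ∫ s in (0 : ℝ)..T, ((-l * c s + k * f s) * φ s + c s * (l * φ s - g s)) =
      ∫ s in (0 : ℝ)..T, (k * (φ s * f s) - c s * g s) :=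
    intervalIntegral.integral_congr fun s _ => by ring
  rw [h1, intervalIntegral.integral_sub ((hf.continuousOn_mul hφu).const_mul k)
    (hg.continuousOn_mul hcu), intervalIntegral.integral_const_mul] at e
  linarith

end duhamel

lemma hasDerivAt_sin_mul (m x : ℝ) :
    HasDerivAt (fun x : ℝ => Real.sin (m * x)) (m * Real.cos (m * x)) x := by
  have h : HasDerivAt (fun x : ℝ => m * x) m x := by simpa using (hasDerivAt_id x).const_mul m
  simpa [mul_comm] using h.sin

lemma hasDerivAt_cos_mul (m x : ℝ) :
    HasDerivAt (fun x : ℝ => Real.cos (m * x)) (-(m * Real.sin (m * x))) x := by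
  have h : HasDerivAt (fun x : ℝ => m * x) m x := by simpa using (hasDerivAt_id x).const_mul m
  simpa [mul_comm] using h.cos

/-- The solutions of `y'' + m² y = 0`, `y(0) = 0` are the multiples of `sin (m x)`. -/
lemma eq_sin_of_ode {y y' : ℝ → ℝ} {m : ℝ} (hm : m ≠ 0)
    (h1 : ∀ x ∈ Icc (0 : ℝ) 1, HasDerivWithinAt y (y' x) (Icc 0 1) x)
    (h2 : ∀ x ∈ Icc (0 : ℝ) 1, HasDerivWithinAt y' (-(m ^ 2 * y x)) (Icc 0 1) x)
    (h0 : y 0 = 0) {x : ℝ} (hx : x ∈ Icc (0 : ℝ) 1) :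
    y x = y' 0 / m * Real.sin (m * x) ∧ y' x = y' 0 * Real.cos (m * x) := by
  have hs := fun x => (hasDerivAt_sin_mul m x).hasDerivWithinAt (s := Icc 0 1)
  have hc := fun x => (hasDerivAt_cos_mul m x).hasDerivWithinAt (s := Icc 0 1)
  have const : ∀ {A : ℝ → ℝ}, (∀ x ∈ Icc (0 : ℝ) 1, HasDerivWithinAt A 0 (Icc 0 1) x) →
      A x = A 0 := by
    intro A hA
    refine constant_of_has_deriv_right_zero (fun z hz => (hA z hz).continuousWithinAt)
      (fun z hz => ?_) x hx
    exact (hA z (Ico_subset_Icc_self hz)).mono_of_mem_nhdsWithin (Icc_mem_nhdsGE_of_mem hz)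
  -- Rotating `(y', m y)` back by the angle `m x` gives a constant vector.
  have eA := const (A := fun x => y' x * Real.cos (m * x) + m * (y x * Real.sin (m * x)))
    fun x hx => (((h2 x hx).mul (hc x)).add (((h1 x hx).mul (hs x)).const_mul m)).congr_deriv
      (by ring)
  have eB := const (A := fun x => y' x * Real.sin (m * x) - m * (y x * Real.cos (m * x)))
    fun x hx => (((h2 x hx).mul (hs x)).sub (((h1 x hx).mul (hc x)).const_mul m)).congr_deriv
      (by ring)
  simp only [mul_zero, Real.sin_zero, Real.cos_zero, h0, mul_one, add_zero,
    sub_self] at eA eB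
  have h := Real.sin_sq_add_cos_sq (m * x)
  constructor
  · field_simp
    linear_combination Real.sin (m * x) * eA - Real.cos (m * x) * eB - y x * m * h
  · linear_combination Real.cos (m * x) * eA + Real.sin (m * x) * eB - y' x * h

/-! ### Integrals against `ν` and inner products -/

lemma ae_vol01_iff {p : ℝ → Prop} :
    (∀ᵐ x ∂vol01, p x) ↔ ∀ᵐ x ∂(volume.restrict (Ioc (0 : ℝ) 1)), p x := by
  rw [vol01, restrict_Ioo_eq_restrict_Ioc]

lemma ae_nu_iff {a d : ℝ} (h : 0 < a / d) {p : ℝ → Prop} :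
    (∀ᵐ x ∂(nu a d), p x) ↔ (∀ᵐ x ∂vol01, p x) ∧ p 1 := by
  refine ⟨fun hp => ?_, fun hp => ae_nu_of hp.1 hp.2⟩
  unfold nu at hp
  rw [ae_add_measure_iff, Measure.ae_ennreal_smul_measure_iff (by simpa using h), ae_dirac_eq] at hp
  exact hp

lemma inner_L2 (u v : L2) : inner ℝ u v = ∫ x in (0 : ℝ)..1, u x * v x := by
  rw [L2.inner_def, intervalIntegral.integral_of_le zero_le_one, ← restrict_Ioo_eq_restrict_Ioc]
  exact integral_congr_ae (.of_forall fun x => by simp [mul_comm])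

lemma integral_mul_congr {f g u v : ℝ → ℝ} (hf : f =ᵐ[vol01] u) (hg : g =ᵐ[vol01] v) :
    ∫ x in (0 : ℝ)..1, f x * g x = ∫ x in (0 : ℝ)..1, u x * v x := by
  refine integral_congr_L2 ?_ (right_mem_Icc.2 zero_le_one)
  filter_upwards [hf, hg] with x h1 h2
  rw [h1, h2]

lemma inner_L2_congr {u v : L2} {f g : ℝ → ℝ} (hu : u =ᵐ[vol01] f) (hv : v =ᵐ[vol01] g) :
    inner ℝ u v = ∫ x in (0 : ℝ)..1, f x * g x := by
  rw [inner_L2, integral_mul_congr hu hv]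

lemma inner_H {a d : ℝ} (h : 0 < a / d) (U V : H a d) :
    inner ℝ U V = (∫ x in (0 : ℝ)..1, U x * V x) + a / d * (U 1 * V 1) := by
  have hi : Integrable (fun x => inner ℝ (U x) (V x)) (nu a d) := L2.integrable_inner U V
  rw [L2.inner_def]
  unfold nu at hi ⊢
  rw [integral_add_measure hi.left_of_add_measure hi.right_of_add_measure, integral_smul_measure,
    integral_dirac, ENNReal.toReal_ofReal h.le, intervalIntegral.integral_of_le zero_le_one,
    ← restrict_Ioo_eq_restrict_Ioc, smul_eq_mul]
  congr 1
  · exact integral_congr_ae (.of_forall fun x => by simp [mul_comm])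
  · simp [mul_comm]

lemma inner_H_congr {a d : ℝ} (h : 0 < a / d) {U V : H a d} {f g : ℝ → ℝ}
    (hU : U =ᵐ[nu a d] f) (hV : V =ᵐ[nu a d] g) :
    inner ℝ U V = (∫ x in (0 : ℝ)..1, f x * g x) + a / d * (f 1 * g 1) := by
  obtain ⟨h1, h2⟩ := (ae_nu_iff h).1 hU
  obtain ⟨h3, h4⟩ := (ae_nu_iff h).1 hV
  rw [inner_H h, h2, h4, integral_mul_congr h1 h3]

/-- The constant function `1` in `L²(0,1)`. -/
def one : L2 := (memLp_const (1 : ℝ)).toLp _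

lemma one_ae : (one : ℝ → ℝ) =ᵐ[vol01] fun _ => 1 := MemLp.coeFn_toLp _

lemma inner_one (v : L2) : inner ℝ one v = ∫ x in (0 : ℝ)..1, v x := by
  rw [inner_L2_congr one_ae (ae_eq_refl _)]; simp

lemma inner_one_one : inner ℝ one one = (1 : ℝ) := by
  rw [inner_L2_congr one_ae one_ae]; simp

/-! ### Primitives of square integrable functions -/

lemma abs_integral_le (w : L2) {x y : ℝ} (hx : 0 ≤ x) (hxy : x ≤ y) (hy : y ≤ 1) :
    |∫ s in x..y, w s| ≤ √(y - x) * ‖w‖ := by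
  have hm : vol01 (Ioc x y) ≠ ⊤ := measure_ne_top _ _
  have h1 := L2.inner_indicatorConstLp_one (𝕜 := ℝ) measurableSet_Ioc hm w
  have h2 : ∫ s in Ioc x y, w s ∂vol01 = ∫ s in x..y, w s := by
    have h : vol01.restrict (Ioc x y) = volume.restrict (Ioc x y) := by
      rw [vol01, restrict_Ioo_eq_restrict_Ioc, Measure.restrict_restrict measurableSet_Ioc,
        inter_eq_left.2 (Ioc_subset_Ioc hx hy)]
    rw [intervalIntegral.integral_of_le hxy, h]
  rw [← h2, ← h1]
  refine (abs_real_inner_le_norm _ _).trans (mul_le_mul_of_nonneg_right ?_ (norm_nonneg _))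
  rw [norm_indicatorConstLp (by norm_num) (by norm_num)]
  have h3 : vol01.real (Ioc x y) ≤ y - x := by
    rw [← Real.volume_real_Ioc_of_le hxy]
    exact ENNReal.toReal_mono (by simp) (Measure.restrict_le_self _)
  rw [Real.sqrt_eq_rpow]
  simp only [norm_one, one_mul, ENNReal.toReal_ofNat]
  exact Real.rpow_le_rpow measureReal_nonneg h3 (by norm_num)

lemma isPrimitive_L2 (w : L2) (c : ℝ) :
    IsPrimitive (fun x => c + ∫ s in (0 : ℝ)..x, w s) w 1 :=
  ⟨intervalIntegrable_L2 w (right_mem_Icc.2 zero_le_one), fun t _ => by simp⟩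

/-- The derivative of an absolutely continuous function is unique almost everywhere. -/
lemma IsPrimitive.ae_unique {F G p q : ℝ → ℝ} (hF : IsPrimitive F p 1) (hG : IsPrimitive G q 1)
    (h : ∀ x ∈ Icc (0 : ℝ) 1, F x = G x) : p =ᵐ[vol01] q := by
  have key : ∀ {F p : ℝ → ℝ}, IsPrimitive F p 1 →
      ∀ᵐ x ∂vol01, HasDerivAt F (p x) x := by
    intro F p hF
    filter_upwards [ae_restrict_of_ae hF.integrable.ae_hasDerivAt_integral,
      ae_restrict_mem measurableSet_Ioo] with x h1 h2
    have h3 := (h1 (by rw [uIcc_of_le zero_le_one]; exact Ioo_subset_Icc_self h2) 0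
      (by simp)).const_add (F 0)
    refine h3.congr_of_eventuallyEq ?_
    filter_upwards [Icc_mem_nhds h2.1 h2.2] with y hy using hF.eq y hy
  filter_upwards [key hF, key hG, ae_restrict_mem measurableSet_Ioo] with x h1 h2 h3
  refine h1.unique (h2.congr_of_eventuallyEq ?_)
  filter_upwards [Icc_mem_nhds h3.1 h3.2] with y hy using h y hy

/-- The operator `w ↦ (x ↦ ∫₀ˣ w)` from `L²(0,1)` to `C([0,1])`. -/
def primC : L2 →L[ℝ] C(Icc (0 : ℝ) 1, ℝ) :=
  LinearMap.mkContinuous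
    { toFun := fun w => ⟨fun x => ∫ s in (0 : ℝ)..x, w s, by
        have h := (isPrimitive_L2 w 0).continuousOn zero_le_one
        simp only [zero_add] at h
        exact continuousOn_iff_continuous_domRestrict.1 h⟩
      map_add' := fun u v => by ext x; exact integral_add_L2 u v x.2
      map_smul' := fun c u => by ext x; exact integral_smul_L2 c u x.2 } 1 (fun w => by
    rw [one_mul]
    refine (ContinuousMap.norm_le _ (norm_nonneg _)).2 fun x => ?_
    refine (abs_integral_le w le_rfl x.2.1 x.2.2).trans ?_
    exact mul_le_of_le_one_left (norm_nonneg _) (Real.sqrt_le_one.2 (by linarith [x.2.2])))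

lemma primC_apply (w : L2) (x : Icc (0 : ℝ) 1) : primC w x = ∫ s in (0 : ℝ)..x, w s := rfl

/-- The primitives of a bounded set of `L²(0,1)` are uniformly Hölder continuous of order `1/2`, so
the Arzelà-Ascoli theorem applies. -/
lemma isCompactOperator_primC : IsCompactOperator primC := by
  refine (isCompactOperator_iff_isCompact_closure_image_ball
    (primC : L2 →ₗ[ℝ] C(Icc (0 : ℝ) 1, ℝ)) one_pos).2 ?_
  let e : C(Icc (0 : ℝ) 1, ℝ) ≃ᵢ BoundedContinuousFunction (Icc (0 : ℝ) 1) ℝ :=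
    ContinuousMap.isometryEquivBoundedOfCompact _ _
  have h : IsCompact (closure (e '' (primC '' Metric.ball 0 1))) := by
    refine BoundedContinuousFunction.arzela_ascoli (Icc (-1) 1) isCompact_Icc _ ?_ ?_
    · rintro _ x ⟨_, ⟨w, hw, rfl⟩, rfl⟩
      refine mem_Icc.2 (abs_le.1 ?_)
      refine (abs_integral_le w le_rfl x.2.1 x.2.2).trans ?_
      exact mul_le_one₀ (Real.sqrt_le_one.2 (by linarith [x.2.2])) (norm_nonneg _)
        (by simpa using (mem_ball_zero_iff.1 hw).le)
    · refine Metric.equicontinuous_of_continuity_modulus (fun r => √r) ?_ _ ?_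
      · simpa using (Real.continuous_sqrt.tendsto 0)
      · rintro x y ⟨_, ⟨_, ⟨w, hw, rfl⟩, rfl⟩⟩
        have hw' : ‖w‖ ≤ 1 := (mem_ball_zero_iff.1 hw).le
        have main : ∀ x y : Icc (0 : ℝ) 1, x ≤ y → |primC w x - primC w y| ≤ √(dist x y) := by
          intro x y hxy
          have hxy' : (x : ℝ) ≤ y := hxy
          rw [abs_sub_comm, primC_apply, primC_apply,
            intervalIntegral.integral_interval_sub_left (intervalIntegrable_L2 w y.2)
              (intervalIntegrable_L2 w x.2)]
          refine (abs_integral_le w x.2.1 hxy y.2.2).trans ?_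
          have : dist x y = (y : ℝ) - x := by
            rw [Subtype.dist_eq, dist_comm, Real.dist_eq, abs_of_nonneg (by linarith)]
          rw [this]
          exact mul_le_of_le_one_right (Real.sqrt_nonneg _) hw'
        change |primC w x - primC w y| ≤ √(dist x y)
        rcases le_total x y with hxy | hxy
        · exact main x y hxy
        · rw [abs_sub_comm, dist_comm]; exact main y x hxy
  have h2 := h.image e.symm.continuous
  rw [← IsometryEquiv.coe_toHomeomorph, Homeomorph.image_closure, ← image_comp] at h2
  simpa [Function.comp_def] using h2

/-- The extension of a continuous function on `[0,1]` that is constant on either side. -/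
def extB : C(Icc (0 : ℝ) 1, ℝ) →L[ℝ] BoundedContinuousFunction ℝ ℝ :=
  LinearMap.mkContinuous
    { toFun := fun f => (BoundedContinuousFunction.mkOfCompact f).compContinuous
        ⟨projIcc 0 1 zero_le_one, continuous_projIcc⟩
      map_add' := fun f g => by ext; rfl
      map_smul' := fun c f => by ext; rfl } 1 fun f => by
    rw [one_mul]
    refine (BoundedContinuousFunction.norm_le (norm_nonneg _)).2 fun x => ?_
    exact f.norm_coe_le_norm _

/-- The class of `extB f` in `L²(μ)`. -/
def extLp (μ : Measure ℝ) [IsFiniteMeasure μ] : C(Icc (0 : ℝ) 1, ℝ) →L[ℝ] Lp ℝ 2 μ :=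
  (BoundedContinuousFunction.toLp 2 μ ℝ).comp extB

lemma extLp_ae (μ : Measure ℝ) [IsFiniteMeasure μ] (f : C(Icc (0 : ℝ) 1, ℝ)) :
    extLp μ f =ᵐ[μ] fun x => f (projIcc 0 1 zero_le_one x) :=
  BoundedContinuousFunction.coeFn_toLp 2 μ ℝ (extB f)

lemma primC_projIcc (w : L2) {x : ℝ} (hx : x ∈ Icc (0 : ℝ) 1) :
    primC w (projIcc 0 1 zero_le_one x) = ∫ s in (0 : ℝ)..x, w s := by
  rw [projIcc_of_mem _ hx]; rfl

lemma extLp_primC_nu (a d : ℝ) (w : L2) :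
    extLp (nu a d) (primC w) =ᵐ[nu a d] fun x => ∫ s in (0 : ℝ)..x, w s := by
  filter_upwards [extLp_ae (nu a d) (primC w), ae_mem_Ioc a d] with x h1 h2
  rw [h1, primC_projIcc w (Ioc_subset_Icc_self h2)]

lemma extLp_primC_vol (w : L2) :
    extLp vol01 (primC w) =ᵐ[vol01] fun x => ∫ s in (0 : ℝ)..x, w s := by
  filter_upwards [extLp_ae vol01 (primC w), ae_restrict_mem measurableSet_Ioo] with x h1 h2
  rw [h1, primC_projIcc w (Ioo_subset_Icc_self h2)]

/-! ### The spaces `H₁` and `H` -/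

/-- The weak derivative `u_x` of `(u, u₁) ∈ H₁`. -/
def der {a d : ℝ} (p : H1 a d) : L2 := (p : H a d × L2).2

/-- The absolutely continuous representative of `(u, u₁) ∈ H₁` on `[0,1]`. -/
def rep {a d : ℝ} (p : H1 a d) (x : ℝ) : ℝ := ∫ s in (0 : ℝ)..x, der p s

section

variable {a d : ℝ}

lemma rep_zero (p : H1 a d) : rep p 0 = 0 := by simp [rep]

lemma isPrimitive_rep (p : H1 a d) : IsPrimitive (rep p) (der p) 1 := by
  have h := isPrimitive_L2 (der p) 0
  simp only [zero_add] at h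
  exact h

lemma toH_ae (p : H1 a d) : toH a d p =ᵐ[nu a d] rep p := p.2

lemma rep_one (p : H1 a d) : rep p 1 = inner ℝ one (der p) := (inner_one _).symm

lemma toH_one (h : 0 < a / d) (p : H1 a d) : toH a d p 1 = rep p 1 :=
  ((ae_nu_iff h).1 (toH_ae p)).2

/-- `H₁` is parametrised by the weak derivative: `u ↦ u_x` is an isomorphism onto `L²(0,1)`. -/
def derE (a d : ℝ) : H1 a d ≃L[ℝ] L2 :=
  ContinuousLinearEquiv.equivOfInverse
    ((ContinuousLinearMap.snd ℝ (H a d) L2).comp (H1 a d).subtypeL)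
    ((((extLp (nu a d)).comp primC).prod (ContinuousLinearMap.id ℝ L2)).codRestrict (H1 a d)
      fun w => extLp_primC_nu a d w)
    (fun p => by
      refine Subtype.ext (Prod.ext ?_ rfl)
      refine Lp.ext ?_
      exact (extLp_primC_nu a d (der p)).trans (toH_ae p).symm)
    (fun w => rfl)

lemma der_derE_symm (w : L2) : der ((derE a d).symm w) = w := rfl

lemma ext_rep {p q : H1 a d} (h : ∀ x ∈ Icc (0 : ℝ) 1, rep p x = rep q x) : p = q := by
  apply (derE a d).injective
  exact Lp.ext ((isPrimitive_rep p).ae_unique (isPrimitive_rep q) h)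

lemma inner_toH (h : 0 < a / d) (p : H1 a d) (V : H a d) :
    inner ℝ (toH a d p) V = (∫ x in (0 : ℝ)..1, rep p x * V x) + a / d * (rep p 1 * V 1) :=
  inner_H_congr h (toH_ae p) (ae_eq_refl _)

lemma memLp_bulk (V : H a d) : MemLp V 2 vol01 :=
  (Lp.memLp V).mono_measure (by unfold nu; exact Measure.le_add_right le_rfl)

/-- The first component of `(u, u₁) ∈ H`. -/
def bulk (V : H a d) : L2 := (memLp_bulk V).toLp _

lemma bulk_ae (V : H a d) : bulk V =ᵐ[vol01] V := MemLp.coeFn_toLp _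

/-- The function `s ↦ ∫ₛ¹ u + (a/d) u₁`, which represents `(V, ·)_H` on `H₁`. -/
def adj (V : H a d) : L2 :=
  ((∫ x in (0 : ℝ)..1, bulk V x) + a / d * V 1) • one - extLp vol01 (primC (bulk V))

lemma adj_ae (V : H a d) : adj V =ᵐ[vol01]
    fun x => ((∫ x in (0 : ℝ)..1, bulk V x) + a / d * V 1) - ∫ s in (0 : ℝ)..x, bulk V s := by
  filter_upwards [Lp.coeFn_sub (((∫ x in (0 : ℝ)..1, bulk V x) + a / d * V 1) • one)
    (extLp vol01 (primC (bulk V))), extLp_primC_vol (bulk V), one_ae,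
    Lp.coeFn_smul ((∫ x in (0 : ℝ)..1, bulk V x) + a / d * V 1) one] with x h1 h2 h3 h4
  rw [adj, h1, Pi.sub_apply, h2, h4, Pi.smul_apply, h3, smul_eq_mul, mul_one]

lemma inner_toH_eq_adj (h : 0 < a / d) (V : H a d) (p : H1 a d) :
    inner ℝ V (toH a d p) = inner ℝ (adj V) (der p) := by
  have hB := isPrimitive_L2 (bulk V) 0
  simp only [zero_add] at hB
  have hp := hB.mul (isPrimitive_rep p) zero_le_one
  have e := hp.sub_eq zero_le_one
  have e1 : inner ℝ (extLp vol01 (primC (bulk V))) (der p) =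
      ∫ x in (0 : ℝ)..1, (∫ s in (0 : ℝ)..x, bulk V s) * der p x :=
    inner_L2_congr (extLp_primC_vol _) (ae_eq_refl _)
  rw [adj, inner_sub_left, real_inner_smul_left, e1, ← rep_one, real_inner_comm, inner_toH h]
  have e2 : ∫ x in (0 : ℝ)..1, rep p x * V x = ∫ x in (0 : ℝ)..1, bulk V x * rep p x := by
    rw [integral_mul_congr (ae_eq_refl (rep p)) (bulk_ae V).symm]
    simp only [mul_comm]
  have hc := (isPrimitive_rep p).continuousOn zero_le_one
  have hd := hB.continuousOn zero_le_one
  rw [← uIcc_of_le (zero_le_one (α := ℝ))] at hc hd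
  rw [intervalIntegral.integral_add (hB.integrable.mul_continuousOn hc)
    ((isPrimitive_rep p).integrable.continuousOn_mul hd)] at e
  simp only [rep_zero, intervalIntegral.integral_same, mul_zero, sub_zero] at e
  rw [e2]
  linear_combination e

lemma eqOn_of_ae_vol01 {f g : ℝ → ℝ} (h : f =ᵐ[vol01] g) (hf : ContinuousOn f (Icc 0 1))
    (hg : ContinuousOn g (Icc 0 1)) : EqOn f g (Icc 0 1) := by
  refine Measure.eqOn_Icc_of_ae_eq volume zero_ne_one ?_ hf hg
  rwa [← restrict_Ioo_eq_restrict_Icc]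

/-- `H₁` is dense in `H`. -/
lemma eq_zero_of_inner_toH (h : 0 < a / d) {V : H a d}
    (hV : ∀ p : H1 a d, inner ℝ V (toH a d p) = 0) : V = 0 := by
  have h1 : adj V = 0 := by
    have := hV ((derE a d).symm (adj V))
    rw [inner_toH_eq_adj h, der_derE_symm] at this
    exact inner_self_eq_zero.1 this
  have hB := isPrimitive_L2 (bulk V) 0
  simp only [zero_add] at hB
  have h2 : EqOn (fun x => ((∫ x in (0 : ℝ)..1, bulk V x) + a / d * V 1) -
      ∫ s in (0 : ℝ)..x, bulk V s) (fun _ => 0) (Icc 0 1) := by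
    refine eqOn_of_ae_vol01 ?_ (continuousOn_const.sub (hB.continuousOn zero_le_one))
      continuousOn_const
    refine (adj_ae V).symm.trans ?_
    rw [h1]; exact Lp.coeFn_zero ..
  have h3 : V 1 = 0 := by
    have := h2 (right_mem_Icc.2 zero_le_one)
    simp only [add_sub_cancel_left] at this
    exact (mul_eq_zero.1 this).resolve_left h.ne'
  have h4 : (bulk V : ℝ → ℝ) =ᵐ[vol01] fun _ => 0 := by
    refine hB.ae_unique (G := fun _ => 0) ⟨by simp, by simp⟩ fun x hx => ?_
    have h5 := h2 hx
    have h6 := h2 (left_mem_Icc.2 zero_le_one)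
    simp only [intervalIntegral.integral_same] at h5 h6
    linarith
  refine Lp.ext (EventuallyEq.trans ?_ (Lp.coeFn_zero ..).symm)
  exact ae_nu_of (((bulk_ae V).symm.trans h4)) h3

end

/-! ### The energy inner product -/

/-- The operator `w ↦ w + (r - 1) (1, w) 1`, which multiplies the mean value of `w` by `r`. -/
def scaleMean (r : ℝ) : L2 →L[ℝ] L2 :=
  ContinuousLinearMap.id ℝ L2 + (r - 1) • (innerSL ℝ one).smulRight one

lemma scaleMean_apply (r : ℝ) (w : L2) :
    scaleMean r w = w + ((r - 1) * inner ℝ one w) • one := by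
  simp [scaleMean, smul_smul]

lemma scaleMean_scaleMean {r s : ℝ} (h : r * s = 1) (w : L2) :
    scaleMean r (scaleMean s w) = w := by
  rw [scaleMean_apply, scaleMean_apply, inner_add_right, real_inner_smul_right, inner_one_one,
    add_assoc, ← add_smul]
  have : (s - 1) * inner ℝ one w + (r - 1) * (inner ℝ one w + (s - 1) * inner ℝ one w * 1) = 0 := by
    linear_combination (inner ℝ one w) * h
  rw [this]; simp

lemma inner_scaleMean (r : ℝ) (v w : L2) :
    inner ℝ (scaleMean r v) (scaleMean r w) =
      inner ℝ v w + (r ^ 2 - 1) * (inner ℝ one v * inner ℝ one w) := by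
  simp only [scaleMean_apply, inner_add_left, inner_add_right, real_inner_smul_left,
    real_inner_smul_right, inner_one_one, real_inner_comm one v]
  ring

/-- `E : H₁ → L²(0,1)` turns the energy form `∫₀¹ u_x v_x - β u(1) v(1)`, `β < 1`, into the inner
product of `L²(0,1)`. -/
def energyE (a d : ℝ) {β : ℝ} (hβ : β < 1) : H1 a d ≃L[ℝ] L2 :=
  (derE a d).trans (ContinuousLinearEquiv.equivOfInverse
    (scaleMean (√(1 - β))) (scaleMean (√(1 - β))⁻¹)
    (scaleMean_scaleMean (inv_mul_cancel₀ (Real.sqrt_pos.2 (by linarith)).ne'))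
    (scaleMean_scaleMean (mul_inv_cancel₀ (Real.sqrt_pos.2 (by linarith)).ne')))

lemma inner_energyE {a d β : ℝ} (hβ : β < 1) (p q : H1 a d) :
    inner ℝ (energyE a d hβ p) (energyE a d hβ q) =
      inner ℝ (der p) (der q) - β * (rep p 1 * rep q 1) := by
  change inner ℝ (scaleMean _ (der p)) (scaleMean _ (der q)) = _
  rw [inner_scaleMean, Real.sq_sqrt (by linarith), rep_one, rep_one]
  ring

/-- The embedding of `H₁`, with its energy inner product, into `H` is compact. -/
lemma isCompactOperator_toH (a d : ℝ) : IsCompactOperator (toH a d) := by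
  have h : (toH a d : H1 a d → H a d) =
      fun p => ((extLp (nu a d)).comp primC) ((derE a d : H1 a d →L[ℝ] L2) p) := by
    funext p
    change toH a d p = toH a d ((derE a d).symm (derE a d p))
    simp
  rw [h]
  exact (isCompactOperator_primC.clm_comp (extLp (nu a d))).comp_clm _

/-! ### Eigenfunctions -/

/-- `m > 0` and `m ^ 2` is an eigenvalue: `sin (m x)` satisfies the boundary condition at `1`. -/
def IsFreq (a b d m : ℝ) : Prop :=
  0 < m ∧ (a * m ^ 2 + b) * Real.sin m = d * (m * Real.cos m)

section

variable {a b d m : ℝ}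

lemma isPrimitive_sin (m x : ℝ) :
    IsPrimitive (fun x => Real.sin (m * x)) (fun x => m * Real.cos (m * x)) x :=
  .of_hasDerivAt (hasDerivAt_sin_mul m) (by fun_prop) x

lemma isPrimitive_mul_cos (m x : ℝ) :
    IsPrimitive (fun x => m * Real.cos (m * x)) (fun x => -m ^ 2 * Real.sin (m * x)) x :=
  .of_hasDerivAt (fun t => ((hasDerivAt_cos_mul m t).const_mul m).congr_deriv (by ring))
    (by fun_prop) x

lemma der_Y_ae : der (Y a d m) =ᵐ[vol01] fun x => m * Real.cos (m * x) :=
  (memLp_cos m vol01).coeFn_toLp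

lemma toH_Y_ae : toH a d (Y a d m) =ᵐ[nu a d] fun x => Real.sin (m * x) :=
  (memLp_sin m (nu a d)).coeFn_toLp

lemma rep_Y {x : ℝ} (hx : x ∈ Icc (0 : ℝ) 1) : rep (Y a d m) x = Real.sin (m * x) := by
  rw [rep, integral_congr_L2 der_Y_ae hx, (isPrimitive_sin m x).sub_eq hx.1]
  simp

/-- `Y` is an eigenvector of the energy form relative to the inner product of `H`. -/
lemma energy_Y (h : 0 < a / d) (hβ : b / d < 1) (hm : IsFreq a b d m) (p : H1 a d) :
    inner ℝ (energyE a d hβ (Y a d m)) (energyE a d hβ p) =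
      m ^ 2 * inner ℝ (toH a d (Y a d m)) (toH a d p) := by
  have hd : d ≠ 0 := by rintro rfl; simp at h
  have hi := (isPrimitive_mul_cos m 1).mul (isPrimitive_rep p) zero_le_one
  have e := hi.sub_eq zero_le_one
  have hc := (isPrimitive_rep p).continuousOn zero_le_one
  rw [← uIcc_of_le (zero_le_one (α := ℝ))] at hc
  rw [intervalIntegral.integral_add ((isPrimitive_mul_cos m 1).integrable.mul_continuousOn hc)
    ((isPrimitive_rep p).integrable.continuousOn_mul (by fun_prop))] at e
  rw [inner_energyE, inner_H_congr h toH_Y_ae (toH_ae p), rep_Y (right_mem_Icc.2 zero_le_one),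
    inner_L2_congr der_Y_ae (ae_eq_refl _)]
  simp only [mul_assoc, intervalIntegral.integral_const_mul, rep_zero, mul_zero, mul_one] at e ⊢
  rw [eq_sub_of_add_eq' e]
  have hm2 : m * Real.cos m = (a * m ^ 2 + b) * Real.sin m / d := by
    rw [hm.2]; field_simp
  have : m * (Real.cos m * rep p 1) = (m * Real.cos m) * rep p 1 := by ring
  rw [this, hm2]
  field_simp
  ring

lemma toH_injective (h : 0 < a / d) : Function.Injective (toH a d) := by
  refine (injective_iff_map_eq_zero _).2 fun p hp => ?_
  have h1 : rep p =ᵐ[vol01] fun _ => 0 := by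
    have e1 := ((ae_nu_iff h).1 (toH_ae p)).1
    rw [hp] at e1
    filter_upwards [e1, ((ae_nu_iff h).1 (Lp.coeFn_zero ℝ 2 (nu a d))).1] with x h1 h2
    rw [← h1, h2, Pi.zero_apply]
  have h2 := eqOn_of_ae_vol01 h1 ((isPrimitive_rep p).continuousOn zero_le_one) continuousOn_const
  refine ext_rep fun x hx => ?_
  have h3 : rep (0 : H1 a d) x = 0 := integral_zero_L2 hx
  rw [h2 hx, h3]

lemma rep_smul (c : ℝ) (p : H1 a d) {x : ℝ} (hx : x ∈ Icc (0 : ℝ) 1) :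
    rep (c • p) x = c * rep p x := integral_smul_L2 c (der p) hx

/-- Regularity: a weak eigenvector with positive eigenvalue is a multiple of some `sin (m x)`. -/
lemma eq_smul_Y_of_weak (h : 0 < a / d) (hβ : b / d < 1) (hm : 0 < m) {u : H1 a d} (hu : u ≠ 0)
    (hw : ∀ p : H1 a d, inner ℝ (energyE a d hβ u) (energyE a d hβ p) =
      m ^ 2 * inner ℝ (toH a d u) (toH a d p)) :
    IsFreq a b d m ∧ ∃ c : ℝ, u = c • Y a d m := by
  have hd : d ≠ 0 := by rintro rfl; simp at h
  set r := rep u 1 with hr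
  -- The weak equation determines `u_x`, which therefore has a continuous representative `D`.
  have h1 : der u = m ^ 2 • adj (toH a d u) + (b / d * r) • one := by
    rw [← sub_eq_zero]
    set z := der u - (m ^ 2 • adj (toH a d u) + (b / d * r) • one) with hz
    have h2 := hw ((derE a d).symm z)
    rw [inner_energyE, inner_toH_eq_adj h, rep_one ((derE a d).symm z), der_derE_symm] at h2
    refine inner_self_eq_zero (𝕜 := ℝ).1 ?_
    nth_rw 1 [hz]
    rw [inner_sub_left, inner_add_left, real_inner_smul_left, real_inner_smul_left]
    linear_combination h2
  have hb : bulk (toH a d u) =ᵐ[vol01] rep u :=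
    (bulk_ae _).trans ((ae_nu_iff h).1 (toH_ae u)).1
  let g : ℝ → ℝ := extB (primC (der u))
  have hg : Continuous g := (extB (primC (der u))).continuous
  have hgr : ∀ x ∈ Icc (0 : ℝ) 1, g x = rep u x := fun x hx => primC_projIcc _ hx
  have hbg : bulk (toH a d u) =ᵐ[vol01] g := by
    filter_upwards [hb, ae_restrict_mem measurableSet_Ioo] with x hx hx2
    rw [hx, hgr x (Ioo_subset_Icc_self hx2)]
  let C := (∫ x in (0 : ℝ)..1, g x) + a / d * r
  let D : ℝ → ℝ := fun x => m ^ 2 * (C - ∫ s in (0 : ℝ)..x, g s) + b / d * r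
  let y : ℝ → ℝ := fun x => ∫ s in (0 : ℝ)..x, D s
  have hD : ∀ x, HasDerivAt D (-(m ^ 2 * g x)) x := fun x => by
    have := (((hg.integral_hasStrictDerivAt 0 x).hasDerivAt.const_sub C).const_mul
      (m ^ 2)).add_const (b / d * r)
    exact this.congr_deriv (by ring)
  have hDc : Continuous D := continuous_iff_continuousAt.2 fun x => (hD x).continuousAt
  have hy : ∀ x, HasDerivAt y (D x) x := fun x => (hDc.integral_hasStrictDerivAt 0 x).hasDerivAt
  have hder : der u =ᵐ[vol01] D := by
    rw [h1]
    filter_upwards [Lp.coeFn_add (m ^ 2 • adj (toH a d u)) ((b / d * r) • one),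
      Lp.coeFn_smul (m ^ 2) (adj (toH a d u)), Lp.coeFn_smul (b / d * r) one, one_ae,
      adj_ae (toH a d u), ae_restrict_mem measurableSet_Ioo] with x e1 e2 e3 e4 e5 hx
    rw [e1, Pi.add_apply, e2, e3, Pi.smul_apply, Pi.smul_apply, e4, e5, toH_one h,
      integral_congr_L2 hbg (right_mem_Icc.2 zero_le_one),
      integral_congr_L2 hbg (Ioo_subset_Icc_self hx)]
    simp [D, C, hr]
  have hry : ∀ x ∈ Icc (0 : ℝ) 1, rep u x = y x := fun x hx => integral_congr_L2 hder hx
  have hsol : ∀ x ∈ Icc (0 : ℝ) 1, y x = D 0 / m * Real.sin (m * x) ∧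
      D x = D 0 * Real.cos (m * x) := fun x hx =>
    eq_sin_of_ode hm.ne' (fun x _ => (hy x).hasDerivWithinAt)
      (fun x hx => by rw [← hry x hx, ← hgr x hx]; exact (hD x).hasDerivWithinAt)
      (by simp [y]) hx
  have hu2 : u = (D 0 / m) • Y a d m := ext_rep fun x hx => by
    rw [hry x hx, (hsol x hx).1, rep_smul _ _ hx, rep_Y hx]
  refine ⟨⟨hm, ?_⟩, _, hu2⟩
  have h0 : D 0 ≠ 0 := fun h0 => hu (by rw [hu2, h0]; simp)
  obtain ⟨s1, s2⟩ := hsol 1 (right_mem_Icc.2 zero_le_one)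
  have hD1 : D 1 = (m ^ 2 * (a / d) + b / d) * r := by simp only [D, C]; ring
  rw [mul_one] at s1 s2
  rw [hD1, hr, hry 1 (right_mem_Icc.2 zero_le_one), s1] at s2
  field_simp at s2
  linear_combination s2

/-! ### The Dirichlet lift of the boundary value `1` -/

/-- The solution `h(x) = 1 + (b / (d - b)) x` of `h'' = 0`, `h(0) = 1`, `d h'(1) = b h(1)`. -/
def lift (a b d : ℝ) : H a d :=
  extLp (nu a d) ⟨fun x => 1 + b / (d - b) * (x : ℝ), by fun_prop⟩

lemma lift_ae : lift a b d =ᵐ[nu a d] fun x => 1 + b / (d - b) * x := by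
  filter_upwards [extLp_ae (nu a d) ⟨fun x => 1 + b / (d - b) * (x : ℝ), by fun_prop⟩,
    ae_mem_Ioc a d] with x h1 h2
  rw [lift, h1, projIcc_of_mem _ (Ioc_subset_Icc_self h2)]
  rfl

/-- The constant in the Dirichlet lift has a nonzero denominator. -/
lemma sub_ne_zero_of_div_lt_one (hd : d ≠ 0) (hβ : b / d < 1) : d - b ≠ 0 := by
  intro h0
  have : b = d := by linarith
  rw [this, div_self hd] at hβ
  exact lt_irrefl _ hβ

/-- The choice of `h'(1)` makes the boundary terms at `1` cancel. -/
lemma inner_lift_Y (h : 0 < a / d) (hβ : b / d < 1) (hm : IsFreq a b d m) :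
    inner ℝ (lift a b d) (toH a d (Y a d m)) = 1 / m := by
  have hd : d ≠ 0 := by rintro rfl; simp at h
  have hdb := sub_ne_zero_of_div_lt_one hd hβ
  obtain ⟨hm0, hm1⟩ := hm
  have hm' := hm0.ne'
  rw [inner_H_congr h lift_ae toH_Y_ae]
  set c := b / (d - b) with hc
  have key : ∫ x in (0 : ℝ)..1, (1 + c * x) * Real.sin (m * x) =
      (-(1 + c) * Real.cos m / m + c * Real.sin m / m ^ 2) + 1 / m := by
    rw [intervalIntegral.integral_eq_sub_of_hasDerivAt
      (f := fun x => -((1 + c * x) * Real.cos (m * x)) / m + c * Real.sin (m * x) / m ^ 2)]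
    · simp; ring
    · intro x _
      have h1 : HasDerivAt (fun x : ℝ => 1 + c * x) c x := by
        simpa using ((hasDerivAt_id x).const_mul c).const_add 1
      refine (((h1.mul (hasDerivAt_cos_mul m x)).neg.div_const m).add
        (((hasDerivAt_sin_mul m x).const_mul c).div_const (m ^ 2))).congr_deriv ?_
      field_simp
      ring
    · exact (by fun_prop : Continuous fun x : ℝ =>
        (1 + c * x) * Real.sin (m * x)).intervalIntegrable _ _
  rw [key]
  have hcos : Real.cos m = (a * m ^ 2 + b) * Real.sin m / (d * m) := by
    field_simp; linarith
  rw [mul_one, mul_one, hcos, hc]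
  field_simp
  ring

lemma normY_pos (h : 0 < a / d) (hβ : b / d < 1) (hm : IsFreq a b d m) : 0 < normY a d m := by
  refine norm_pos_iff.2 fun h0 => ?_
  have := inner_lift_Y h hβ hm
  rw [h0, inner_zero_right] at this
  exact (one_div_pos.2 hm.1).ne this

lemma normY_sq_le (h : 0 < a / d) : normY a d m ^ 2 ≤ 1 + a / d := by
  rw [normY, ← real_inner_self_eq_norm_sq, inner_H_congr h toH_Y_ae toH_Y_ae]
  have h1 : ∫ x in (0 : ℝ)..1, Real.sin (m * x) * Real.sin (m * x) ≤
      ∫ x in (0 : ℝ)..1, (1 : ℝ) := by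
    refine intervalIntegral.integral_mono_on zero_le_one
      ((by fun_prop : Continuous fun x : ℝ =>
        Real.sin (m * x) * Real.sin (m * x)).intervalIntegrable _ _) (by simp) fun x _ => ?_
    rw [← sq]; exact Real.sin_sq_le_one _
  have h2 : Real.sin (m * 1) * Real.sin (m * 1) ≤ 1 := by rw [← sq]; exact Real.sin_sq_le_one _
  simp only [intervalIntegral.integral_const, sub_zero, smul_eq_mul, mul_one] at h1
  nlinarith

lemma toH_Z : toH a d (Z a d m) = (normY a d m)⁻¹ • toH a d (Y a d m) := map_smul _ _ _

lemma energy_Z (h : 0 < a / d) (hβ : b / d < 1) (hm : IsFreq a b d m) (p : H1 a d) :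
    inner ℝ (energyE a d hβ (Z a d m)) (energyE a d hβ p) =
      m ^ 2 * inner ℝ (toH a d (Z a d m)) (toH a d p) := by
  rw [toH_Z, Z, map_smul, real_inner_smul_left, real_inner_smul_left, energy_Y h hβ hm]
  ring

/-- `(h, Z)_H = κ / m²` with `κ = m / ‖Y‖_H`, the derivative at `0` of the first component of
`Z`. -/
lemma inner_lift_Z (h : 0 < a / d) (hβ : b / d < 1) (hm : IsFreq a b d m) :
    inner ℝ (lift a b d) (toH a d (Z a d m)) = m / normY a d m / m ^ 2 := by
  rw [toH_Z, real_inner_smul_right, inner_lift_Y h hβ hm]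
  have := hm.1.ne'
  field_simp

lemma orthonormal_Z (h : 0 < a / d) (hβ : b / d < 1) :
    Orthonormal ℝ (fun m : {m // IsFreq a b d m} => toH a d (Z a d m)) := by
  constructor
  · intro m
    change ‖toH a d (Z a d m)‖ = 1
    rw [toH_Z, norm_smul, norm_inv, Real.norm_of_nonneg (show 0 ≤ normY a d m from norm_nonneg _)]
    exact inv_mul_cancel₀ (normY_pos h hβ m.2).ne'
  · intro m m' hne
    have e1 := energy_Z h hβ m.2 (Z a d m')
    have e2 := energy_Z h hβ m'.2 (Z a d m)
    have e3 : ((m : ℝ) ^ 2 - (m' : ℝ) ^ 2) *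
        inner ℝ (toH a d (Z a d m)) (toH a d (Z a d m')) = 0 := by
      rw [sub_mul, sub_eq_zero, ← e1, real_inner_comm, e2, real_inner_comm]
    refine (mul_eq_zero.1 e3).resolve_left fun h0 => hne (Subtype.ext ?_)
    exact (pow_left_inj₀ m.2.1.le m'.2.1.le two_ne_zero).1 (sub_eq_zero.1 h0)

end

/-! ### The sequence of eigenvalues -/

section

variable {a b d m : ℝ}

lemma IsFreq.isEigenfunction (hm : IsFreq a b d m) :
    IsEigenfunction a b d (m ^ 2) fun x => Real.sin (m * x) := by
  obtain ⟨hm0, hm1⟩ := hm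
  refine ⟨⟨min 1 m⁻¹, ⟨by positivity, min_le_left _ _⟩, ?_⟩, by simp,
    fun x => m * Real.cos (m * x), fun x _ => (hasDerivAt_sin_mul m x).hasDerivWithinAt,
    fun x _ => ?_, by simpa using hm1⟩
  · refine (Real.sin_pos_of_pos_of_lt_pi (by positivity) ?_).ne'
    have h1 : m * min 1 m⁻¹ ≤ 1 := by
      rw [← mul_inv_cancel₀ hm0.ne']
      exact mul_le_mul_of_nonneg_left (min_le_right _ _) hm0.le
    linarith [Real.pi_gt_three]
  · exact (((hasDerivAt_cos_mul m x).const_mul m).congr_deriv (by ring)).hasDerivWithinAt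

lemma IsPrimitive.of_hasDerivWithinAt {F p : ℝ → ℝ}
    (h : ∀ x ∈ Icc (0 : ℝ) 1, HasDerivWithinAt F (p x) (Icc 0 1) x)
    (hp : ContinuousOn p (Icc 0 1)) : IsPrimitive F p 1 := by
  have hi : IntervalIntegrable p volume 0 1 := by
    refine ContinuousOn.intervalIntegrable ?_
    rwa [uIcc_of_le zero_le_one]
  refine ⟨hi, fun t ht => ?_⟩
  have hi' : IntervalIntegrable p volume 0 t := by
    refine hi.mono_set ?_
    rw [uIcc_of_le ht.1, uIcc_of_le zero_le_one]
    exact Icc_subset_Icc_right ht.2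
  rw [intervalIntegral.integral_eq_sub_of_hasDerivAt_of_le ht.1
    (fun x hx => ((h x ⟨hx.1, hx.2.trans ht.2⟩).continuousWithinAt).mono
      (Icc_subset_Icc_right ht.2)) (fun x hx => ?_) hi']
  · ring
  · exact (h x ⟨hx.1.le, hx.2.le.trans ht.2⟩).hasDerivAt
      (Icc_mem_nhds hx.1 (hx.2.trans_le ht.2))

/-- The energy identity `∫ y'² - (b/d) y(1)² = λ (∫ y² + (a/d) y(1)²)` forces `λ > 0`. -/
lemma IsEigenfunction.pos (h : 0 < a / d) (hβ : b / d < 1) {lam : ℝ} {y : ℝ → ℝ}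
    (hy : IsEigenfunction a b d lam y) : 0 < lam := by
  have hd : d ≠ 0 := by rintro rfl; simp at h
  obtain ⟨⟨x₀, hx₀, hne⟩, h0, y', h1, h2, h3⟩ := hy
  have hc : ContinuousOn y (Icc 0 1) := fun x hx => (h1 x hx).continuousWithinAt
  have hc' : ContinuousOn y' (Icc 0 1) := fun x hx => (h2 x hx).continuousWithinAt
  have p1 := IsPrimitive.of_hasDerivWithinAt h1 hc'
  have p2 := IsPrimitive.of_hasDerivWithinAt h2 (by fun_prop)
  rw [← uIcc_of_le (zero_le_one (α := ℝ))] at hc hc'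
  by_contra! hl
  have e := (p2.mul p1 zero_le_one).sub_eq zero_le_one
  have i1 : IntervalIntegrable (fun x => y x ^ 2) volume 0 1 := (hc.pow 2).intervalIntegrable
  have i2 : IntervalIntegrable (fun x => y' x ^ 2) volume 0 1 := (hc'.pow 2).intervalIntegrable
  have e1 : ∫ x in (0 : ℝ)..1, (-(lam * y x) * y x + y' x * y' x) =
      -lam * (∫ x in (0 : ℝ)..1, y x ^ 2) + ∫ x in (0 : ℝ)..1, y' x ^ 2 := by
    rw [← intervalIntegral.integral_const_mul, ← intervalIntegral.integral_add (i1.const_mul _) i2]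
    exact intervalIntegral.integral_congr fun x _ => by ring
  rw [e1, h0] at e
  have e2 : ∫ x in (0 : ℝ)..1, (y' x - y 1) ^ 2 = (∫ x in (0 : ℝ)..1, y' x ^ 2) - y 1 ^ 2 := by
    have : ∫ x in (0 : ℝ)..1, (y' x - y 1) ^ 2 =
        ∫ x in (0 : ℝ)..1, (y' x ^ 2 + (-(2 * y 1) * y' x + y 1 ^ 2)) :=
      intervalIntegral.integral_congr fun x _ => by ring
    rw [this, intervalIntegral.integral_add i2 ((p1.integrable.const_mul _).add (by simp)),
      intervalIntegral.integral_add (p1.integrable.const_mul _) (by simp),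
      intervalIntegral.integral_const_mul, p1.sub_eq zero_le_one, h0]
    simp; ring
  have n1 : 0 ≤ ∫ x in (0 : ℝ)..1, (y' x - y 1) ^ 2 :=
    intervalIntegral.integral_nonneg zero_le_one fun x _ => sq_nonneg _
  have n2 : 0 ≤ ∫ x in (0 : ℝ)..1, y x ^ 2 :=
    intervalIntegral.integral_nonneg zero_le_one fun x _ => sq_nonneg _
  have n3 : 0 ≤ ∫ x in (0 : ℝ)..1, y' x ^ 2 :=
    intervalIntegral.integral_nonneg zero_le_one fun x _ => sq_nonneg _
  have h4 : y' 1 * y 1 = (a / d * lam + b / d) * y 1 ^ 2 := by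
    field_simp
    linear_combination (-y 1) * h3
  have n4 : lam * (a / d * y 1 ^ 2) ≤ 0 := mul_nonpos_of_nonpos_of_nonneg hl (by positivity)
  have n5 : lam * (∫ x in (0 : ℝ)..1, y x ^ 2) ≤ 0 := mul_nonpos_of_nonpos_of_nonneg hl n2
  have n6 : ∫ x in (0 : ℝ)..1, y' x ^ 2 ≤ b / d * y 1 ^ 2 := by nlinarith
  have n7 : y 1 ^ 2 = 0 := by nlinarith [sq_nonneg (y 1)]
  have n8 : ∫ x in (0 : ℝ)..1, y' x ^ 2 = 0 := le_antisymm (by rwa [n7, mul_zero] at n6) n3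
  rw [intervalIntegral.integral_of_le zero_le_one, integral_eq_zero_iff_of_nonneg
    (fun x => sq_nonneg _) ((intervalIntegrable_iff_integrableOn_Ioc_of_le zero_le_one).1 i2)] at n8
  apply hne
  rw [p1.eq x₀ hx₀, h0, zero_add, intervalIntegral.integral_of_le hx₀.1]
  refine integral_eq_zero_of_ae ?_
  filter_upwards [ae_restrict_of_ae_restrict_of_subset (Ioc_subset_Ioc_right hx₀.2) n8] with x hx
  simpa using hx

lemma isEigenvalue_iff (h : 0 < a / d) (hβ : b / d < 1) {lam : ℝ} :
    IsEigenvalue a b d lam ↔ ∃ m, IsFreq a b d m ∧ lam = m ^ 2 := by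
  refine ⟨?_, ?_⟩
  · rintro ⟨y, hy⟩
    have hl := hy.pos h hβ
    obtain ⟨⟨x₀, hx₀, hne⟩, h0, y', h1, h2, h3⟩ := hy
    have hs : lam = √lam ^ 2 := (Real.sq_sqrt hl.le).symm
    have hm := Real.sqrt_pos.2 hl
    refine ⟨√lam, ⟨hm, ?_⟩, hs⟩
    have hsol : ∀ x ∈ Icc (0 : ℝ) 1, _ := fun x hx => eq_sin_of_ode hm.ne' h1
      (fun x hx => by rw [← hs]; exact h2 x hx) h0 hx
    have hA : y' 0 ≠ 0 := fun hA => hne (by rw [(hsol x₀ hx₀).1, hA]; simp)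
    obtain ⟨s1, s2⟩ := hsol 1 (right_mem_Icc.2 zero_le_one)
    rw [s1, s2, mul_one] at h3
    rw [← hs]
    field_simp at h3
    linear_combination h3
  · rintro ⟨m, hm, rfl⟩
    exact ⟨_, hm.isEigenfunction⟩

/-- By the intermediate value theorem there is a frequency in `(π/2 + 2kπ, 3π/2 + 2kπ)` for every
large `k`. -/
lemma exists_isFreq_gt (ha : a ≠ 0) (M : ℝ) : ∃ m, IsFreq a b d m ∧ M < m := by
  obtain ⟨k, hk⟩ := exists_nat_gt (max M (max 1 (-(b / a))))
  simp only [max_lt_iff] at hk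
  obtain ⟨hk1, hk2, hk3⟩ := hk
  set p : ℝ := Real.pi / 2 + k * (2 * Real.pi) with hp
  have hpi := Real.pi_gt_three
  have hkp : (k : ℝ) < p := by nlinarith
  have sp : Real.sin p = 1 := by rw [hp, Real.sin_add_nat_mul_two_pi, Real.sin_pi_div_two]
  have cp : Real.cos p = 0 := by rw [hp, Real.cos_add_nat_mul_two_pi, Real.cos_pi_div_two]
  have pos : ∀ q, p ≤ q → 0 < a * (a * q ^ 2 + b) := by
    intro q hq
    have h1 : a * (a * q ^ 2 + b) = a ^ 2 * (q ^ 2 + b / a) := by field_simp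
    rw [h1]
    have : 0 < a ^ 2 := by positivity
    exact mul_pos this (by nlinarith)
  let G : ℝ → ℝ := fun q => a * ((a * q ^ 2 + b) * Real.sin q - d * (q * Real.cos q))
  have hG : ContinuousOn G (Icc p (p + Real.pi)) := by fun_prop
  have g1 : 0 ≤ G p := by
    simp only [G, sp, cp]
    have := pos p le_rfl
    linarith
  have g2 : G (p + Real.pi) ≤ 0 := by
    simp only [G, Real.sin_add_pi, Real.cos_add_pi, sp, cp]
    have := pos (p + Real.pi) (by linarith)
    linarith
  obtain ⟨m, hm, hm0⟩ := intermediate_value_Icc' (by linarith) hG ⟨g2, g1⟩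
  refine ⟨m, ⟨by linarith [hm.1], ?_⟩, by linarith [hm.1]⟩
  linarith [(mul_eq_zero.1 hm0).resolve_left ha]

/-- Bessel's inequality for the Dirichlet lift bounds the number of frequencies below `M`. -/
lemma finite_isFreq_le (h : 0 < a / d) (hβ : b / d < 1) (M : ℝ) :
    {m | IsFreq a b d m ∧ m ≤ M}.Finite := by
  by_contra hinf
  obtain ⟨N, hN⟩ := exists_nat_gt (‖lift a b d‖ ^ 2 * (M ^ 2 * (1 + a / d)))
  obtain ⟨s, hs, hsN⟩ := Set.Infinite.exists_subset_card_eq hinf (N + 1)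
  have hsub : ∀ m ∈ s, IsFreq a b d m := fun m hm => (hs hm).1
  have hB := (orthonormal_Z h hβ).sum_inner_products_le (lift a b d)
    (s := s.attach.map ⟨fun m => ⟨m.1, hsub m.1 m.2⟩, fun x y hxy =>
      Subtype.ext (Subtype.mk.inj hxy)⟩)
  rw [Finset.sum_map] at hB
  have hle : ∀ m ∈ s.attach, (M ^ 2 * (1 + a / d))⁻¹ ≤
      ‖inner ℝ (toH a d (Z a d m)) (lift a b d)‖ ^ 2 := by
    intro m _
    have hm := hsub m.1 m.2
    have hn := normY_pos h hβ hm
    have hm0 := hm.1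
    rw [real_inner_comm, inner_lift_Z h hβ hm, Real.norm_eq_abs, sq_abs]
    have : ((m : ℝ) / normY a d m / (m : ℝ) ^ 2) ^ 2 = ((m : ℝ) ^ 2 * normY a d m ^ 2)⁻¹ := by
      field_simp
    rw [this]
    refine inv_anti₀ (by positivity) ?_
    exact mul_le_mul (pow_le_pow_left₀ hm0.le (hs m.2).2 2) (normY_sq_le h) (by positivity)
      (by positivity)
  have h1 := Finset.card_nsmul_le_sum _ _ _ hle
  have h2 := h1.trans hB
  have hM : 0 < M ^ 2 * (1 + a / d) := by
    obtain ⟨m, hm⟩ : s.Nonempty := Finset.card_pos.1 (by omega)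
    have : 0 < M := (hsub m hm).1.trans_le (hs hm).2
    positivity
  rw [Finset.card_attach, hsN, nsmul_eq_mul, ← div_eq_mul_inv, div_le_iff₀ hM] at h2
  push_cast at h2
  linarith

/-- A set of reals, unbounded above, that has finitely many elements below each bound
is the range of a strictly increasing sequence. -/
lemma exists_strictMono_range_eq {S : Set ℝ} (hf : ∀ M, {m | m ∈ S ∧ m ≤ M}.Finite)
    (hu : ∀ M, ∃ m ∈ S, M < m) : ∃ μ : ℕ → ℝ, StrictMono μ ∧ range μ = S := by
  have hnext : ∀ M, ∃ m, IsLeast {m | m ∈ S ∧ M < m} m := by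
    intro M
    obtain ⟨m₀, hm₀, hM⟩ := hu M
    obtain ⟨m, hm, hmin⟩ := ((hf m₀).subset (t := {m | (m ∈ S ∧ M < m) ∧ m ≤ m₀})
      fun x hx => ⟨hx.1.1, hx.2⟩).exists_minimal ⟨m₀, ⟨hm₀, hM⟩, le_rfl⟩
    refine ⟨m, hm.1, fun x hx => ?_⟩
    rcases le_total x m₀ with h | h
    · by_contra! hlt
      exact absurd (hmin ⟨hx, h⟩ hlt.le) (not_le.2 hlt)
    · exact hm.2.trans h
  -- `nx M` is the least element of `S` above `M`.
  choose nx hnx using hnext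
  obtain ⟨m₁, hm₁, -⟩ := hu 0
  obtain ⟨μ₀, hμ₀, hmin⟩ := (hf m₁).exists_minimal ⟨m₁, hm₁, le_rfl⟩
  let μ : ℕ → ℝ := fun n => nx^[n] μ₀
  have hsucc : ∀ n, μ (n + 1) = nx (μ n) := fun n => Function.iterate_succ_apply' _ _ _
  have hmono : StrictMono μ := strictMono_nat_of_lt_succ fun n => by
    rw [hsucc]; exact (hnx (μ n)).1.2
  have hmem : ∀ n, μ n ∈ S := by
    rintro (_ | n)
    · exact hμ₀.1
    · rw [hsucc]; exact (hnx (μ n)).1.1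
  refine ⟨μ, hmono, Subset.antisymm (range_subset_iff.2 hmem) fun m hm => ?_⟩
  by_contra hne
  have hlt : ∀ n, μ n < m := by
    intro n
    induction n with
    | zero =>
      rcases le_total m m₁ with h | h
      · refine lt_of_le_of_ne ?_ fun e => hne ⟨0, e⟩
        by_contra! hlt
        exact absurd (hmin ⟨hm, h⟩ hlt.le) (not_le.2 hlt)
      · exact lt_of_le_of_ne (hμ₀.2.trans h) fun e => hne ⟨0, e⟩
    | succ n ih =>
      refine lt_of_le_of_ne ?_ fun e => hne ⟨_, e⟩
      rw [hsucc]
      exact (hnx (μ n)).2 ⟨hm, ih⟩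
  exact (infinite_range_of_injective hmono.injective)
    ((hf m).subset (range_subset_iff.2 fun n => ⟨hmem n, (hlt n).le⟩))

/-- `μ` enumerates the frequencies in increasing order. -/
structure IsFreqSeq (a b d : ℝ) (μ : ℕ → ℝ) : Prop where
  strictMono : StrictMono μ
  iff : ∀ m, IsFreq a b d m ↔ ∃ n, μ n = m

lemma exists_isFreqSeq (h : 0 < a / d) (hβ : b / d < 1) : ∃ μ, IsFreqSeq a b d μ := by
  have ha : a ≠ 0 := by rintro rfl; simp at h
  obtain ⟨μ, h1, h2⟩ := exists_strictMono_range_eq (S := {m | IsFreq a b d m})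
    (finite_isFreq_le h hβ) (fun M => exists_isFreq_gt ha M)
  exact ⟨μ, h1, fun m => (Set.ext_iff.1 h2 m).symm⟩

end

/-! ### Hilbert bases of eigenvectors and the Fourier expansion -/

section

variable {a b d : ℝ} {μ : ℕ → ℝ}

lemma IsFreqSeq.isFreq (hμ : IsFreqSeq a b d μ) (n : ℕ) : IsFreq a b d (μ n) :=
  (hμ.iff _).2 ⟨n, rfl⟩

lemma IsFreqSeq.pos (hμ : IsFreqSeq a b d μ) (n : ℕ) : 0 < μ n := (hμ.isFreq n).1

lemma IsFreqSeq.orthonormal (h : 0 < a / d) (hβ : b / d < 1) (hμ : IsFreqSeq a b d μ) :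
    Orthonormal ℝ fun n => toH a d (Z a d (μ n)) :=
  (orthonormal_Z h hβ).comp (fun n => (⟨μ n, hμ.isFreq n⟩ : {m // IsFreq a b d m}))
    fun _ _ hij => hμ.strictMono.injective (Subtype.mk.inj hij)

/-- A vector orthogonal to all the eigenvectors vanishes, by the spectral theorem for the compact
self-adjoint operator `ι* ι`, where `ι` embeds `H₁` with its energy inner product into `H`. -/
lemma eq_zero_of_forall_inner_energyE_Y (h : 0 < a / d) (hβ : b / d < 1) {w : L2}
    (hw : ∀ m, IsFreq a b d m → inner ℝ (energyE a d hβ (Y a d m)) w = 0) : w = 0 := by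
  set E := energyE a d hβ with hE
  let ι : L2 →L[ℝ] H a d := (toH a d).comp (E.symm : L2 →L[ℝ] H1 a d)
  let K : L2 →L[ℝ] L2 := (ContinuousLinearMap.adjoint ι).comp ι
  have hι : IsCompactOperator ι := (isCompactOperator_toH a d).comp_clm (E.symm : L2 →L[ℝ] H1 a d)
  have hK : IsCompactOperator K := hι.clm_comp (ContinuousLinearMap.adjoint ι)
  have hKi : ∀ v w, inner ℝ (K v) w = inner ℝ (ι v) (ι w) := fun v w =>
    ContinuousLinearMap.adjoint_inner_left ι w (ι v)
  have hKs : K.IsSymmetric := fun v w => by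
    change inner ℝ (K v) w = inner ℝ v (K w)
    rw [hKi, real_inner_comm (K w), hKi, real_inner_comm]
  have hbot := ContinuousLinearMap.orthogonalComplement_iSup_eigenspaces_eq_bot hK hKs
  have hmem : w ∈ (⨆ κ, Module.End.eigenspace (K : Module.End ℝ L2) κ)ᗮ := by
    rw [Submodule.mem_orthogonal]
    intro v hv
    refine Submodule.iSup_induction _ (motive := fun v => inner ℝ v w = 0) hv ?_ (by simp)
      fun x y hx hy => by rw [inner_add_left, hx, hy, add_zero]
    intro κ v hv
    have hKv : K v = κ • v := Module.End.mem_eigenspace_iff.1 hv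
    by_cases hv0 : v = 0
    · simp [hv0]
    have hu0 : E.symm v ≠ 0 := by simpa using hv0
    have e1 : ‖ι v‖ ^ 2 = κ * ‖v‖ ^ 2 := by
      rw [← real_inner_self_eq_norm_sq, ← hKi, hKv, real_inner_smul_left,
        real_inner_self_eq_norm_sq]
    have hιv : 0 < ‖ι v‖ := norm_pos_iff.2 fun h0 => hu0
      (toH_injective h (by rw [map_zero]; exact h0))
    have hvn : 0 < ‖v‖ := norm_pos_iff.2 hv0
    have hκ : 0 < κ := by
      by_contra! hk
      nlinarith [mul_nonneg (neg_nonneg.2 hk) (sq_nonneg ‖v‖), sq_pos_of_pos hιv]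
    have hs : √κ⁻¹ ^ 2 = κ⁻¹ := Real.sq_sqrt (by positivity)
    obtain ⟨hm, c, hc⟩ := eq_smul_Y_of_weak (m := √κ⁻¹) h hβ (by positivity) hu0 fun p => by
      have e2 := hKi v (E p)
      rw [hKv, real_inner_smul_left] at e2
      simp only [ι, ContinuousLinearMap.comp_apply, ContinuousLinearEquiv.coe_coe,
        ContinuousLinearEquiv.symm_apply_apply] at e2
      rw [hs, ← e2, ← hE, ContinuousLinearEquiv.apply_symm_apply]
      field_simp
    rw [← E.apply_symm_apply v, hc, map_smul, real_inner_smul_left, hw _ hm, mul_zero]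
  rw [hbot] at hmem
  exact (Submodule.mem_bot ℝ).1 hmem

lemma exists_energyBasis (h : 0 < a / d) (hβ : b / d < 1) (hμ : IsFreqSeq a b d μ) :
    ∃ B : HilbertBasis ℕ ℝ L2, ∀ n, B n = (μ n)⁻¹ • energyE a d hβ (Z a d (μ n)) := by
  have ho : Orthonormal ℝ fun n => (μ n)⁻¹ • energyE a d hβ (Z a d (μ n)) := by
    rw [orthonormal_iff_ite]
    intro i j
    rw [real_inner_smul_left, real_inner_smul_right, energy_Z h hβ (hμ.isFreq i),
      orthonormal_iff_ite.1 (hμ.orthonormal h hβ) i j]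
    have := (hμ.pos i).ne'
    split_ifs with hij
    · subst hij; field_simp
    · simp
  refine ⟨HilbertBasis.mkOfOrthogonalEqBot ho ?_, fun n => by
    rw [HilbertBasis.coe_mkOfOrthogonalEqBot]⟩
  rw [eq_bot_iff]
  intro w hw
  rw [Submodule.mem_orthogonal] at hw
  refine (Submodule.mem_bot ℝ).2 (eq_zero_of_forall_inner_energyE_Y h hβ fun m hm => ?_)
  obtain ⟨n, rfl⟩ := (hμ.iff m).1 hm
  have e := hw _ (Submodule.subset_span (mem_range_self n))
  rw [real_inner_smul_left, Z, map_smul, real_inner_smul_left] at e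
  have h1 := inv_ne_zero (hμ.pos n).ne'
  have h2 := inv_ne_zero (normY_pos h hβ hm).ne'
  exact (mul_eq_zero.1 ((mul_eq_zero.1 e).resolve_left h1)).resolve_left h2

/-- The Riesz isomorphism of `𝓗` for the energy inner product of `H₁`. -/
def riesz (a d : ℝ) {β : ℝ} (hβ : β < 1) : L2 →L[ℝ] Hminus1 a d :=
  ((ContinuousLinearMap.compL ℝ (H1 a d) L2 ℝ).flip
    (energyE a d hβ : H1 a d →L[ℝ] L2)).comp (innerSL ℝ)

lemma riesz_apply {β : ℝ} (hβ : β < 1) (w : L2) (p : H1 a d) :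
    riesz a d hβ w p = inner ℝ w (energyE a d hβ p) := rfl

lemma riesz_surjective {β : ℝ} (hβ : β < 1) : Function.Surjective (riesz a d hβ) := by
  intro U
  refine ⟨(InnerProductSpace.toDual ℝ L2).symm
    (U.comp ((energyE a d hβ).symm : L2 →L[ℝ] H1 a d)), ?_⟩
  ext p
  rw [riesz_apply, InnerProductSpace.toDual_symm_apply]
  simp

lemma pivot_apply (V : H a d) (p : H1 a d) : pivot a d V p = inner ℝ V (toH a d p) := rfl

lemma riesz_energyE_Z (h : 0 < a / d) (hβ : b / d < 1) {m : ℝ} (hm : IsFreq a b d m) :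
    riesz a d hβ (energyE a d hβ (Z a d m)) = m ^ 2 • pivot a d (toH a d (Z a d m)) := by
  ext p
  rw [riesz_apply, energy_Z h hβ hm]
  rfl

/-- The Fourier expansion in `𝓗`. -/
lemma hasSum_expansion (h : 0 < a / d) (hβ : b / d < 1) (hμ : IsFreqSeq a b d μ)
    (U : Hminus1 a d) :
    HasSum (fun n => U (Z a d (μ n)) • pivot a d (toH a d (Z a d (μ n)))) U := by
  obtain ⟨B, hB⟩ := exists_energyBasis h hβ hμ
  obtain ⟨w, rfl⟩ := riesz_surjective hβ U
  have hs := (B.hasSum_repr w).mapL (riesz a d hβ)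
  have key : ∀ n, riesz a d hβ (B.repr w n • B n) = riesz a d hβ w (Z a d (μ n)) •
      pivot a d (toH a d (Z a d (μ n))) := fun n => by
    have hn := (hμ.pos n).ne'
    rw [B.repr_apply_apply, hB, map_smul, map_smul, real_inner_smul_left,
      riesz_energyE_Z h hβ (hμ.isFreq n), riesz_apply, real_inner_comm w, smul_smul, smul_smul]
    congr 1
    field_simp
  simpa only [key] using hs

lemma eq_zero_of_forall_Z (h : 0 < a / d) (hβ : b / d < 1) (hμ : IsFreqSeq a b d μ)
    {U : Hminus1 a d} (hU : ∀ n, U (Z a d (μ n)) = 0) : U = 0 := by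
  refine (hasSum_expansion h hβ hμ U).unique ?_
  simp [hU, hasSum_zero]

lemma exists_basis (h : 0 < a / d) (hβ : b / d < 1) (hμ : IsFreqSeq a b d μ) :
    ∃ B : HilbertBasis ℕ ℝ (H a d), ∀ n, B n = toH a d (Z a d (μ n)) := by
  refine ⟨HilbertBasis.mkOfOrthogonalEqBot (hμ.orthonormal h hβ) ?_, fun n => by
    rw [HilbertBasis.coe_mkOfOrthogonalEqBot]⟩
  rw [eq_bot_iff]
  intro V hV
  rw [Submodule.mem_orthogonal] at hV
  have h1 : pivot a d V = 0 := eq_zero_of_forall_Z h hβ hμ fun n => by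
    rw [pivot_apply, real_inner_comm]
    exact hV _ (Submodule.subset_span (mem_range_self n))
  exact (Submodule.mem_bot ℝ).2 (eq_zero_of_inner_toH h fun p => by
    rw [← pivot_apply, h1]; rfl)

end

/-! ### The operator `𝓐` -/

section

variable {a b d m : ℝ}

lemma pair_ae (w : L2) (r : ℝ) : pair a d w r =ᵐ[nu a d] Function.update (w : ℝ → ℝ) 1 r :=
  (memLp_update a d w r).coeFn_toLp

lemma pair_ae_vol (h : 0 < a / d) (w : L2) (r : ℝ) : pair a d w r =ᵐ[vol01] w :=
  EventuallyEq.trans ((ae_nu_iff h).1 (pair_ae w r)).1 (update_ae_eq _ _)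

lemma pair_one (h : 0 < a / d) (w : L2) (r : ℝ) : pair a d w r 1 = r := by
  rw [((ae_nu_iff h).1 (pair_ae w r)).2, Function.update_self]

lemma ext_H {U V : H a d} (h1 : U =ᵐ[vol01] V) (h2 : U 1 = V 1) : U = V :=
  Lp.ext (ae_nu_of h1 h2)

/-- `pair` as a continuous linear map. -/
def pairL (h : 0 < a / d) : L2 × ℝ →L[ℝ] H a d :=
  LinearMap.mkContinuous
    { toFun := fun p => pair a d p.1 p.2
      map_add' := fun p q => by
        obtain ⟨h1, h2⟩ := (ae_nu_iff h).1 (Lp.coeFn_add (pair a d p.1 p.2) (pair a d q.1 q.2))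
        refine ext_H ?_ ?_
        · filter_upwards [h1, pair_ae_vol h (p + q).1 (p + q).2, pair_ae_vol h p.1 p.2,
            pair_ae_vol h q.1 q.2, Lp.coeFn_add p.1 q.1] with x e1 e2 e3 e4 e5
          rw [e1, e2, Pi.add_apply, e3, e4, Prod.fst_add, e5, Pi.add_apply]
        · rw [h2, Pi.add_apply, pair_one h, pair_one h, pair_one h, Prod.snd_add]
      map_smul' := fun c p => by
        obtain ⟨h1, h2⟩ := (ae_nu_iff h).1 (Lp.coeFn_smul c (pair a d p.1 p.2))
        refine ext_H ?_ ?_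
        · filter_upwards [h1, pair_ae_vol h (c • p).1 (c • p).2, pair_ae_vol h p.1 p.2,
            Lp.coeFn_smul c p.1] with x e1 e2 e3 e5
          rw [RingHom.id_apply, e1, e2, Pi.smul_apply, e3, Prod.smul_fst, e5, Pi.smul_apply]
        · rw [RingHom.id_apply, h2, Pi.smul_apply, pair_one h, pair_one h, Prod.smul_snd] }
    (√(1 + a / d)) fun p => by
      refine abs_le_of_sq_le_sq' ?_ (by positivity) |>.2
      change ‖pair a d p.1 p.2‖ ^ 2 ≤ _
      rw [mul_pow, Real.sq_sqrt (by positivity), ← real_inner_self_eq_norm_sq, inner_H h,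
        pair_one h, integral_mul_congr (pair_ae_vol h _ _) (pair_ae_vol h _ _), ← inner_L2,
        real_inner_self_eq_norm_sq]
      have e1 : ‖p.1‖ ^ 2 ≤ ‖p‖ ^ 2 := pow_le_pow_left₀ (norm_nonneg _) (norm_fst_le p) 2
      have e2 : p.2 * p.2 ≤ ‖p‖ ^ 2 := by
        rw [← sq, ← sq_abs]
        exact pow_le_pow_left₀ (abs_nonneg _) (norm_snd_le p) 2
      nlinarith

/-- `toH1` as a continuous linear map. -/
def toH1L (a d : ℝ) : H2 a d →L[ℝ] H1 a d :=
  (ContinuousLinearMap.fst ℝ (H1 a d) (L2 × ℝ)).comp (H2 a d).subtypeL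

/-- `dxx` as a continuous linear map. -/
def dxxL (a d : ℝ) : H2 a d →L[ℝ] L2 :=
  ((ContinuousLinearMap.fst ℝ L2 ℝ).comp (ContinuousLinearMap.snd ℝ (H1 a d) (L2 × ℝ))).comp
    (H2 a d).subtypeL

/-- `dx0` as a continuous linear functional. -/
def dx0L (a d : ℝ) : H2 a d →L[ℝ] ℝ :=
  ((ContinuousLinearMap.snd ℝ L2 ℝ).comp (ContinuousLinearMap.snd ℝ (H1 a d) (L2 × ℝ))).comp
    (H2 a d).subtypeL

lemma dx0L_apply (p : H2 a d) : dx0L a d p = dx0 p := rfl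

lemma dx1_eq (p : H2 a d) : dx1 p = dx0 p + inner ℝ one (dxx p) := by rw [dx1, inner_one]

/-- `𝓐` as a continuous linear map from `H₂` to `H`. -/
def opAL (b : ℝ) (h : 0 < a / d) : H2 a d →L[ℝ] H a d :=
  (pairL h).comp ((dxxL a d).prod
    (-(d / a) • (dx0L a d + (innerSL ℝ one).comp (dxxL a d)) +
      (b / a) • (innerSL ℝ one).comp ((derE a d : H1 a d →L[ℝ] L2).comp (toH1L a d))))

lemma opAL_apply (h : 0 < a / d) (p : H2 a d) : opAL b h p = opA a b d p := by
  rw [opA, toH_one h, rep_one, dx1_eq]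
  rfl

/-- Green's formula for `𝓐` against a `C²` function `k`. -/
lemma inner_opA (h : 0 < a / d) (p : H2 a d) {K : H a d} {k k' k'' : ℝ → ℝ}
    (hK : K =ᵐ[nu a d] k) (h1 : ∀ x, HasDerivAt k (k' x) x) (h2 : ∀ x, HasDerivAt k' (k'' x) x)
    (hc : Continuous k'') :
    inner ℝ (opA a b d p) K = -(dx0 p * k 0) + rep (toH1 p) 1 * (b / d * k 1 - k' 1) +
      ∫ x in (0 : ℝ)..1, rep (toH1 p) x * k'' x := by
  have hd : d ≠ 0 := by rintro rfl; simp at h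
  have ha : a ≠ 0 := by rintro rfl; simp at h
  have hk' : Continuous k' := continuous_iff_continuousAt.2 fun x => (h2 x).continuousAt
  have hk : Continuous k := continuous_iff_continuousAt.2 fun x => (h1 x).continuousAt
  have P1 := isPrimitive_L2 (dxx p) (dx0 p)
  have P2 : IsPrimitive (rep (toH1 p)) (fun x => dx0 p + ∫ s in (0 : ℝ)..x, dxx p s) 1 :=
    (isPrimitive_rep (toH1 p)).congr zero_le_one (fun _ _ => rfl)
      (ae_vol01_iff.1 (EventuallyEq.symm p.2))
  set ux : ℝ → ℝ := fun x => dx0 p + ∫ s in (0 : ℝ)..x, dxx p s with hux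
  have Q1 := IsPrimitive.of_hasDerivAt h1 hk' 1
  have Q2 := IsPrimitive.of_hasDerivAt h2 hc 1
  have e1 := (P1.mul Q1 zero_le_one).sub_eq zero_le_one
  have e2 := (P2.mul Q2 zero_le_one).sub_eq zero_le_one
  have c1 := P1.continuousOn zero_le_one
  have c2 := P2.continuousOn zero_le_one
  rw [← uIcc_of_le (zero_le_one (α := ℝ))] at c1 c2
  rw [intervalIntegral.integral_add (P1.integrable.mul_continuousOn hk.continuousOn)
    (Q1.integrable.continuousOn_mul c1)] at e1
  rw [intervalIntegral.integral_add (P2.integrable.mul_continuousOn hk'.continuousOn)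
    (Q2.integrable.continuousOn_mul c2)] at e2
  simp only [rep_zero, zero_mul, sub_zero] at e1 e2
  have hdx1 : ux 1 = dx1 p := rfl
  have hdx0 : ux 0 = dx0 p := by simp [hux]
  have hK' := (ae_nu_iff h).1 hK
  rw [inner_H h, opA, pair_one h, integral_mul_congr (pair_ae_vol h _ _) hK'.1, hK'.2,
    toH_one h]
  rw [← hdx1, ← hdx0]
  have e3 : a / d * ((-(d / a) * ux 1 + b / a * rep (toH1 p) 1) * k 1) =
      -(ux 1 * k 1) + b / d * rep (toH1 p) 1 * k 1 := by field_simp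
  rw [e3]
  linear_combination e1 - e2

/-- The trace `u_x(0)` is read off from `𝓐` and the Dirichlet lift. -/
lemma inner_opA_lift (h : 0 < a / d) (hβ : b / d < 1) (p : H2 a d) :
    inner ℝ (opA a b d p) (lift a b d) = -dx0 p := by
  have hd : d ≠ 0 := by rintro rfl; simp at h
  have hdb := sub_ne_zero_of_div_lt_one hd hβ
  have h1 : ∀ x, HasDerivAt (fun x : ℝ => 1 + b / (d - b) * x) (b / (d - b)) x := fun x => by
    simpa using ((hasDerivAt_id x).const_mul (b / (d - b))).const_add 1
  rw [inner_opA h p lift_ae h1 (fun x => hasDerivAt_const x _) continuous_const]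
  have : b / d * (1 + b / (d - b) * 1) - b / (d - b) = 0 := by field_simp; ring
  rw [this]; simp

lemma inner_opA_Z (h : 0 < a / d) (hm : IsFreq a b d m) (p : H2 a d) :
    inner ℝ (opA a b d p) (toH a d (Z a d m)) =
      -m ^ 2 * inner ℝ (toH a d (toH1 p)) (toH a d (Z a d m)) := by
  have hd : d ≠ 0 := by rintro rfl; simp at h
  rw [toH_Z, real_inner_smul_right, real_inner_smul_right,
    inner_opA h p toH_Y_ae (hasDerivAt_sin_mul m)
      (fun x => (hasDerivAt_cos_mul m x).const_mul m) (by fun_prop),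
    inner_H_congr h (toH_ae (toH1 p)) toH_Y_ae]
  have e : ∫ x in (0 : ℝ)..1, rep (toH1 p) x * (m * -(m * Real.sin (m * x))) =
      -m ^ 2 * ∫ x in (0 : ℝ)..1, rep (toH1 p) x * Real.sin (m * x) := by
    rw [← intervalIntegral.integral_const_mul]
    exact intervalIntegral.integral_congr fun x _ => by ring
  have e2 : b / d * Real.sin (m * 1) - m * Real.cos (m * 1) = -m ^ 2 * (a / d * Real.sin m) := by
    rw [mul_one]
    field_simp
    linear_combination hm.2
  rw [e, e2]
  simp only [mul_zero, Real.sin_zero, mul_one]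
  ring

/-- `Y` as an element of `H₂`. -/
def Y2 (a d m : ℝ) : H2 a d :=
  ⟨(Y a d m, (-m ^ 2) • ((memLp_sin m vol01).toLp _), m), by
    change (der (Y a d m) : ℝ → ℝ) =ᵐ[vol01] _
    filter_upwards [der_Y_ae (a := a) (d := d) (m := m),
      ae_restrict_mem measurableSet_Ioo] with x h1 hx
    have hx' := Ioo_subset_Icc_self hx
    rw [h1, integral_smul_L2 _ _ hx', integral_congr_L2 (memLp_sin m vol01).coeFn_toLp hx',
      ← intervalIntegral.integral_const_mul, (isPrimitive_mul_cos m x).sub_eq hx'.1]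
    simp⟩

/-- `Z` as an element of `H₂`. -/
def Z2 (a d m : ℝ) : H2 a d := (normY a d m)⁻¹ • Y2 a d m

lemma dx0_Z2 : dx0 (Z2 a d m) = m / normY a d m := by
  change (normY a d m)⁻¹ * m = _
  rw [div_eq_inv_mul]

lemma opA_Z2 (h : 0 < a / d) (hm : IsFreq a b d m) :
    opA a b d (Z2 a d m) = -m ^ 2 • toH a d (Z a d m) := by
  have hd : d ≠ 0 := by rintro rfl; simp at h
  have ha : a ≠ 0 := by rintro rfl; simp at h
  have key : opA a b d (Y2 a d m) = -m ^ 2 • toH a d (Y a d m) := by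
    obtain ⟨y1, y2⟩ := (ae_nu_iff h).1 (toH_Y_ae (a := a) (d := d) (m := m))
    obtain ⟨s1, s2⟩ := (ae_nu_iff h).1 (Lp.coeFn_smul (-m ^ 2) (toH a d (Y a d m)))
    have hdd : dxx (Y2 a d m) =ᵐ[vol01] fun x => -m ^ 2 * Real.sin (m * x) := by
      filter_upwards [Lp.coeFn_smul (-m ^ 2) ((memLp_sin m vol01).toLp _),
        (memLp_sin m vol01).coeFn_toLp] with x e1 e2
      change ((-m ^ 2) • ((memLp_sin m vol01).toLp _) : L2) x = _
      rw [e1, Pi.smul_apply, e2, smul_eq_mul]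
    refine ext_H ?_ ?_
    · filter_upwards [pair_ae_vol h (dxx (Y2 a d m)) _, hdd, y1, s1] with x e1 e2 e3 e4
      rw [opA, e1, e2, e4, Pi.smul_apply, e3, smul_eq_mul]
    · have hdx1 : dx1 (Y2 a d m) = m * Real.cos m := by
        rw [dx1, integral_congr_L2 hdd (right_mem_Icc.2 zero_le_one),
          (isPrimitive_mul_cos m 1).sub_eq zero_le_one]
        change m + _ = _
        simp
      rw [s2, Pi.smul_apply, y2, opA, pair_one h, hdx1, toH_one h]
      change _ + b / a * rep (Y a d m) 1 = _
      rw [rep_Y (right_mem_Icc.2 zero_le_one), mul_one, smul_eq_mul]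
      field_simp
      linear_combination hm.2
  rw [← opAL_apply h, Z2, map_smul, opAL_apply h, key, toH_Z, smul_comm]

end

/-! ### Functions of time -/

section

variable {T : ℝ}

lemma intervalIntegral_eq_volT {E : Type*} [NormedAddCommGroup E] [NormedSpace ℝ E] (hT : 0 ≤ T)
    (g : ℝ → E) : ∫ t in (0 : ℝ)..T, g t = ∫ t, g t ∂(volT T) := by
  rw [intervalIntegral.integral_of_le hT, integral_Ioc_eq_integral_Ioo]

lemma intervalIntegrable_iff_volT {E : Type*} [NormedAddCommGroup E] (hT : 0 ≤ T) {g : ℝ → E} :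
    IntervalIntegrable g volume 0 T ↔ Integrable g (volT T) := by
  rw [intervalIntegrable_iff_integrableOn_Ioc_of_le hT, integrableOn_Ioc_iff_integrableOn_Ioo]
  rfl

lemma memLp_of_continuousOn {g : ℝ → ℝ} (hg : ContinuousOn g (Icc 0 T)) : MemLp g 2 (volT T) := by
  obtain ⟨C, hC⟩ := isCompact_Icc.exists_bound_of_continuousOn hg
  refine MemLp.of_bound ((hg.mono Ioo_subset_Icc_self).aestronglyMeasurable measurableSet_Ioo) C ?_
  filter_upwards [ae_restrict_mem measurableSet_Ioo] with x hx using hC x (Ioo_subset_Icc_self hx)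

lemma intervalIntegrable_of_memLp {E : Type*} [NormedAddCommGroup E] (hT : 0 ≤ T) {g : ℝ → E}
    (hg : MemLp g 2 (volT T)) : IntervalIntegrable g volume 0 T :=
  (intervalIntegrable_iff_volT hT).2 (hg.integrable (by norm_num))

lemma ae_Ioc_of_volT {p : ℝ → Prop} (h : ∀ᵐ t ∂(volT T), p t) :
    ∀ᵐ t ∂(volume.restrict (Ioc 0 T)), p t := by
  rwa [← restrict_Ioo_eq_restrict_Ioc]

end

section

variable {a b d : ℝ} {μ : ℕ → ℝ} {T : ℝ}

/-! ### Fourier coefficients of transposition solutions -/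

/-- The Fourier coefficient at time `t`, along `Z`, of the solution of the control system. -/
def coeff (a d m : ℝ) (U₀ : Hminus1 a d) (f : ℝ → ℝ) : ℝ → ℝ :=
  duhamel (m ^ 2) (m / normY a d m) (U₀ (Z a d m)) f

/-- The transposition identity, tested against `G = g Z`, determines the Fourier coefficients. -/
lemma IsTranspositionSolution.apply_Z (h : 0 < a / d) (hT : 0 < T) {m : ℝ}
    (hm : IsFreq a b d m) {U₀ : Hminus1 a d} {f : ℝ → ℝ} (hf : MemLp f 2 (volT T))
    {U : ℝ → Hminus1 a d} (hU : IsTranspositionSolution a b d T U₀ f U) :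
    U T (Z a d m) = coeff a d m U₀ f T := by
  obtain ⟨hUc, V, hV, hUV, htr⟩ := hU
  set l := m ^ 2 with hl
  set c := coeff a d m U₀ f with hc
  have hfi := intervalIntegrable_of_memLp hT.le hf
  have hcc : ContinuousOn c (Icc 0 T) := (isPrimitive_duhamel hT.le hfi).continuousOn hT.le
  have hv : MemLp (fun t => inner ℝ (V t) (toH a d (Z a d m))) 2 (volT T) :=
    hV.inner_const _
  -- The test function is the difference itself, so the identity yields `∫ g² = 0`.
  set g : ℝ → ℝ := fun t => inner ℝ (V t) (toH a d (Z a d m)) - c t with hg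
  have hgL : MemLp g 2 (volT T) := hv.sub (memLp_of_continuousOn hcc)
  have hgi := intervalIntegrable_of_memLp hT.le hgL
  -- `φ` solves `φ' = l φ - g`, `φ(T) = 0`.
  set φ := duhamel (-l) (-1) (∫ s in (0 : ℝ)..T, Real.exp (-l * s) * g s) g with hφ
  have hφp : IsPrimitive φ (fun t => l * φ t - g t) T :=
    (isPrimitive_duhamel hT.le hgi).congr hT.le (fun _ _ => rfl) (.of_forall fun t => by ring)
  have hφT : φ T = 0 := duhamel_eq_zero_iff.2 (by ring)
  have hφc := hφp.continuousOn hT.le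
  have hφL := memLp_of_continuousOn hφc
  have hback : IsBackwardSolution a b d T (fun t => g t • toH a d (Z a d m))
      (fun t => φ t • Z a d m) (fun t => φ t • Z2 a d m) := by
    refine ⟨hφc.smul continuousOn_const, ?_, .of_forall fun t => rfl, fun t ht => ?_⟩
    · exact ContinuousLinearMap.comp_memLp' (E := ℝ) (F := H2 a d)
        (ContinuousLinearMap.toSpanSingleton ℝ (Z2 a d m)) hφL
    · have e1 : ∀ s, opA a b d (φ s • Z2 a d m) + g s • toH a d (Z a d m) =
          (-(l * φ s - g s)) • toH a d (Z a d m) := fun s => by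
        rw [← opAL_apply h, map_smul, opAL_apply h, opA_Z2 h hm, smul_smul, ← add_smul]
        congr 1; ring
      simp only [e1]
      rw [intervalIntegral.integral_smul_const, intervalIntegral.integral_neg,
        ← intervalIntegral.integral_interval_sub_left hφp.integrable (hφp.mono ht).integrable,
        hφp.sub_eq hT.le, (hφp.mono ht).sub_eq ht.1, hφT, map_smul]
      congr 1; ring
  have key := htr _ _ _ ((ContinuousLinearMap.toSpanSingleton ℝ
    (toH a d (Z a d m))).comp_memLp' hgL) hback
  have e1 : ∫ t in (0 : ℝ)..T, dx0 (φ t • Z2 a d m) * f t =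
      m / normY a d m * ∫ t in (0 : ℝ)..T, φ t * f t := by
    rw [← intervalIntegral.integral_const_mul]
    refine intervalIntegral.integral_congr fun t _ => ?_
    simp only [← dx0L_apply, map_smul, smul_eq_mul]
    rw [dx0L_apply, dx0_Z2]; ring
  have dual := duhamel_duality (k := m / normY a d m) (η := U₀ (Z a d m)) hT.le hfi hgi hφp hφT
  rw [e1, map_smul, smul_eq_mul, mul_comm (φ 0), ← dual] at key
  have i1 : IntervalIntegrable (fun t => inner ℝ (V t) (toH a d (Z a d m)) * g t) volume 0 T :=
    (intervalIntegrable_iff_volT hT.le).2 (hv.integrable_mul hgL)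
  have i2 : IntervalIntegrable (fun t => c t * g t) volume 0 T :=
    (intervalIntegrable_iff_volT hT.le).2 ((memLp_of_continuousOn hcc).integrable_mul hgL)
  have hzero : ∫ t, g t ^ 2 ∂(volT T) = 0 := by
    rw [← intervalIntegral_eq_volT hT.le]
    have : ∫ t in (0 : ℝ)..T, g t ^ 2 =
        ∫ t in (0 : ℝ)..T, (inner ℝ (V t) (toH a d (Z a d m)) * g t - c t * g t) :=
      intervalIntegral.integral_congr fun t _ => by simp only [hg]; ring
    rw [this, intervalIntegral.integral_sub i1 i2, sub_eq_zero]
    refine Eq.trans ?_ key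
    refine intervalIntegral.integral_congr fun t _ => ?_
    change _ = inner ℝ (V t) (g t • toH a d (Z a d m))
    rw [real_inner_smul_right, mul_comm]
  rw [integral_eq_zero_iff_of_nonneg (fun t => sq_nonneg _) hgL.integrable_sq] at hzero
  have hae : (fun t => U t (Z a d m)) =ᵐ[volT T] c := by
    filter_upwards [hzero, hUV] with t h1 h2
    have h3 : g t = 0 := by simpa using h1
    rw [h2, pivot_apply]
    exact sub_eq_zero.1 h3
  rw [volT, restrict_Ioo_eq_restrict_Icc] at hae
  refine Measure.eqOn_Icc_of_ae_eq volume hT.ne hae ?_ hcc (right_mem_Icc.2 hT.le)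
  exact hUc.clm_apply continuousOn_const

/-! ### Construction of the solution -/

lemma exists_repr_eq {E : Type*} [NormedAddCommGroup E] [InnerProductSpace ℝ E]
    (B : HilbertBasis ℕ ℝ E) {c : ℕ → ℝ} (hc : Summable fun n => c n ^ 2) :
    ∃ x, ∀ n, inner ℝ (B n) x = c n := by
  have hm : Memℓp c 2 := memℓp_gen (by simpa using hc)
  refine ⟨B.repr.symm ⟨c, hm⟩, fun n => ?_⟩
  rw [← B.repr_apply_apply, LinearIsometryEquiv.apply_symm_apply]

/-- A curve in a Hilbert space is continuous if its Fourier coefficients are continuous and their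
squares have a common summable majorant. -/
lemma continuousOn_of_coeff {E : Type*} [NormedAddCommGroup E] [InnerProductSpace ℝ E]
    (B : HilbertBasis ℕ ℝ E) {x : ℝ → E} {S : Set ℝ} {u : ℕ → ℝ} (hu : Summable u)
    (hc : ∀ n, ContinuousOn (fun t => inner ℝ (B n) (x t)) S)
    (hb : ∀ n, ∀ t ∈ S, inner ℝ (B n) (x t) ^ 2 ≤ u n) : ContinuousOn x S := by
  intro s hs
  have hN : ContinuousOn (fun t => ∑' n, inner ℝ (B n) (x t - x s) ^ 2) S := by
    refine continuousOn_tsum (u := fun n => 4 * u n) (fun n => ?_) (hu.mul_left 4) ?_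
    · simp only [inner_sub_right]
      exact ((hc n).sub continuousOn_const).pow 2
    · intro n t ht
      rw [Real.norm_of_nonneg (sq_nonneg _), inner_sub_right]
      have h1 := hb n t ht
      have h2 := hb n s hs
      nlinarith [sq_nonneg (inner ℝ (B n) (x t) + inner ℝ (B n) (x s))]
  have hN2 : ∀ t, ∑' n, inner ℝ (B n) (x t - x s) ^ 2 = ‖x t - x s‖ ^ 2 := fun t => by
    rw [← real_inner_self_eq_norm_sq, ← B.tsum_inner_mul_inner]
    exact tsum_congr fun n => by rw [sq, real_inner_comm (B n)]
  simp only [hN2] at hN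
  have h1 : Tendsto (fun t => √(‖x t - x s‖ ^ 2)) (𝓝[S] s) (𝓝 0) := by
    have := (hN s hs).sqrt
    simpa [ContinuousWithinAt] using this
  simp only [Real.sqrt_sq (norm_nonneg _)] at h1
  exact tendsto_iff_norm_sub_tendsto_zero.2 h1

/-- The isometry `c ↦ c z` from `L²(0,T)` to `L²(0,T;E)`, for a unit vector `z`. -/
def timeEmb (T : ℝ) {E : Type*} [NormedAddCommGroup E] [InnerProductSpace ℝ E] {z : E}
    (hz : inner ℝ z z = (1 : ℝ)) : Lp ℝ 2 (volT T) →ₗᵢ[ℝ] Lp E 2 (volT T) :=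
  ((ContinuousLinearMap.toSpanSingleton ℝ z).compLpL 2 (volT T)).toLinearMap.isometryOfInner
    fun c c' => by
      change inner ℝ ((ContinuousLinearMap.toSpanSingleton ℝ z).compLpL 2 (volT T) c)
        ((ContinuousLinearMap.toSpanSingleton ℝ z).compLpL 2 (volT T) c') = _
      rw [L2.inner_def, L2.inner_def]
      refine integral_congr_ae ?_
      filter_upwards [(ContinuousLinearMap.toSpanSingleton ℝ z).coeFn_compLpL c,
        (ContinuousLinearMap.toSpanSingleton ℝ z).coeFn_compLpL c'] with t h1 h2
      rw [h1, h2]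
      rw [ContinuousLinearMap.toSpanSingleton_apply, ContinuousLinearMap.toSpanSingleton_apply,
        real_inner_smul_left, real_inner_smul_right, hz, mul_one]
      simp [mul_comm]

lemma timeEmb_ae {E : Type*} [NormedAddCommGroup E] [InnerProductSpace ℝ E] {z : E}
    (hz : inner ℝ z z = (1 : ℝ)) (c : Lp ℝ 2 (volT T)) :
    timeEmb T hz c =ᵐ[volT T] fun t => c t • z :=
  (ContinuousLinearMap.toSpanSingleton ℝ z).coeFn_compLpL c

lemma inner_timeEmb {E : Type*} [NormedAddCommGroup E] [InnerProductSpace ℝ E] {z : E}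
    (hz : inner ℝ z z = (1 : ℝ)) (c : Lp ℝ 2 (volT T)) (G : Lp E 2 (volT T)) :
    inner ℝ (timeEmb T hz c) G = ∫ t, c t * inner ℝ z (G t) ∂(volT T) := by
  rw [L2.inner_def]
  refine integral_congr_ae ?_
  filter_upwards [timeEmb_ae hz c] with t h1
  rw [h1, real_inner_smul_left]

/-- The orthogonal series `V(t) = ∑ c_n(t) z_n` converges in `L²(0,T;E)` if `∑ ∫ c_n²` converges. -/
lemma exists_timeSeries {E : Type*} [NormedAddCommGroup E] [InnerProductSpace ℝ E]
    [CompleteSpace E] {z : ℕ → E} (hz : Orthonormal ℝ z) {c : ℕ → ℝ → ℝ}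
    (hc : ∀ n, MemLp (c n) 2 (volT T))
    (hs : Summable fun n => ∫ t, c n t ^ 2 ∂(volT T)) :
    ∃ V : ℝ → E, MemLp V 2 (volT T) ∧ (∀ n, ∀ᵐ t ∂(volT T), inner ℝ (V t) (z n) = c n t) ∧
      ∀ G : ℝ → E, MemLp G 2 (volT T) →
        HasSum (fun n => ∫ t, c n t * inner ℝ (z n) (G t) ∂(volT T))
          (∫ t, inner ℝ (V t) (G t) ∂(volT T)) := by
  have hz1 : ∀ n, inner ℝ (z n) (z n) = (1 : ℝ) := fun n => by
    rw [real_inner_self_eq_norm_sq, hz.1 n, one_pow]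
  have hfam : OrthogonalFamily ℝ (fun _ : ℕ => Lp ℝ 2 (volT T)) (fun n => timeEmb T (hz1 n)) := by
    intro i j hij v w
    rw [inner_timeEmb]
    refine integral_eq_zero_of_ae ?_
    filter_upwards [timeEmb_ae (hz1 j) w] with t ht
    rw [ht, real_inner_smul_right, hz.2 hij]; simp
  have hnorm : ∀ n, ‖(hc n).toLp (c n)‖ ^ 2 = ∫ t, c n t ^ 2 ∂(volT T) := fun n => by
    rw [← real_inner_self_eq_norm_sq, L2.inner_def]
    refine integral_congr_ae ?_
    filter_upwards [(hc n).coeFn_toLp] with t ht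
    rw [ht]; simp [sq]
  have hsum := (hfam.summable_iff_norm_sq_summable fun n => (hc n).toLp (c n)).2
    (by simpa only [hnorm] using hs)
  obtain ⟨V, hV⟩ := hsum
  have hmain : ∀ G : ℝ → E, MemLp G 2 (volT T) →
      HasSum (fun n => ∫ t, c n t * inner ℝ (z n) (G t) ∂(volT T))
        (∫ t, inner ℝ (V t) (G t) ∂(volT T)) := by
    intro G hG
    have h1 := hV.mapL (innerSL ℝ (hG.toLp G))
    have e1 : ∀ W : Lp E 2 (volT T), innerSL ℝ (hG.toLp G) W =
        ∫ t, inner ℝ (W t) (G t) ∂(volT T) := by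
      intro W
      rw [innerSL_apply_apply, real_inner_comm, L2.inner_def]
      refine integral_congr_ae ?_
      filter_upwards [hG.coeFn_toLp] with t ht
      rw [ht]
    simp only [e1] at h1
    have e2 : ∀ n, ∫ t, inner ℝ (timeEmb T (hz1 n) ((hc n).toLp (c n)) t) (G t) ∂(volT T) =
        ∫ t, c n t * inner ℝ (z n) (G t) ∂(volT T) := fun n => by
      refine integral_congr_ae ?_
      filter_upwards [timeEmb_ae (hz1 n) ((hc n).toLp (c n)), (hc n).coeFn_toLp] with t e1 e2
      rw [e1, e2, real_inner_smul_left]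
    simpa only [e2] using h1
  refine ⟨V, Lp.memLp V, fun n => ?_, hmain⟩
  have h1 := hV.mapL ((innerSL ℝ (z n)).compLpL 2 (volT T))
  have h2 := h1.unique (hasSum_single n fun k hk => ?_)
  · have h3 : (innerSL ℝ (z n)).compLpL 2 (volT T) V = (hc n).toLp (c n) := by
      rw [h2]
      refine Lp.ext ?_
      filter_upwards [(innerSL ℝ (z n)).coeFn_compLpL (timeEmb T (hz1 n) ((hc n).toLp (c n))),
        timeEmb_ae (hz1 n) ((hc n).toLp (c n))] with t e1 e2
      rw [e1, e2, innerSL_apply_apply, real_inner_smul_right, hz1, mul_one]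
    filter_upwards [(innerSL ℝ (z n)).coeFn_compLpL V, (hc n).coeFn_toLp] with t e1 e2
    rw [h3, e2] at e1
    rw [e1, innerSL_apply_apply, real_inner_comm]
  · refine Lp.ext ?_
    filter_upwards [(innerSL ℝ (z n)).coeFn_compLpL (timeEmb T (hz1 k) ((hc k).toLp (c k))),
      timeEmb_ae (hz1 k) ((hc k).toLp (c k)), Lp.coeFn_zero ℝ 2 (volT T)] with t e1 e2 e3
    rw [e1, e2, e3, innerSL_apply_apply, real_inner_smul_right, hz.2 hk.symm]; simp

end

section

variable {a b d : ℝ} {μ : ℕ → ℝ} {T : ℝ}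

/-! ### The backward system and existence of solutions -/

lemma memLp_opA (h : 0 < a / d) {Ψ : ℝ → H2 a d} (hΨ : MemLp Ψ 2 (volT T)) :
    MemLp (fun t => opA a b d (Ψ t)) 2 (volT T) := by
  have := ContinuousLinearMap.comp_memLp' (𝕜 := ℝ) (𝕜' := ℝ) (σ := RingHom.id ℝ) (E := H2 a d)
    (F := H a d) (opAL b h) hΨ
  simpa only [Function.comp_def, opAL_apply] using this

/-- The Fourier coefficients of a strong solution of the backward system solve
`φ' = m² φ - g`, `φ(T) = 0`. -/
lemma IsBackwardSolution.isPrimitive (h : 0 < a / d) (hT : 0 < T) {m : ℝ}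
    (hm : IsFreq a b d m) {G : ℝ → H a d} (hG : MemLp G 2 (volT T)) {Φ : ℝ → H1 a d}
    {Ψ : ℝ → H2 a d} (hΦ : IsBackwardSolution a b d T G Φ Ψ) :
    IsPrimitive (fun t => inner ℝ (toH a d (Φ t)) (toH a d (Z a d m)))
      (fun t => m ^ 2 * inner ℝ (toH a d (Φ t)) (toH a d (Z a d m)) -
        inner ℝ (toH a d (Z a d m)) (G t)) T ∧
    inner ℝ (toH a d (Φ T)) (toH a d (Z a d m)) = (0 : ℝ) := by
  set z := toH a d (Z a d m) with hz
  have hA := memLp_opA (b := b) h hΦ.memLp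
  have hi : IntervalIntegrable (fun t => opA a b d (Ψ t) + G t) volume 0 T :=
    intervalIntegrable_of_memLp hT.le (hA.add hG)
  have hzi : IntervalIntegrable (fun t => innerSL ℝ z (opA a b d (Ψ t) + G t)) volume 0 T :=
    (intervalIntegrable_iff_volT hT.le).2
      ((innerSL ℝ z).integrable_comp ((intervalIntegrable_iff_volT hT.le).1 hi))
  have hsub : ∀ t ∈ Icc 0 T, IntervalIntegrable (fun t => opA a b d (Ψ t) + G t) volume t T :=
    fun t ht => hi.mono_set (by
      rw [uIcc_of_le hT.le, uIcc_of_le ht.2]; exact Icc_subset_Icc_left ht.1)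
  have e : ∀ t ∈ Icc 0 T, inner ℝ (toH a d (Φ t)) z =
      ∫ s in t..T, innerSL ℝ z (opA a b d (Ψ s) + G s) := fun t ht => by
    rw [hΦ.equation t ht, real_inner_comm, ← innerSL_apply_apply ℝ,
      ContinuousLinearMap.intervalIntegral_comp_comm _ (hsub t ht)]
  have hp : IsPrimitive (fun t => inner ℝ (toH a d (Φ t)) z)
      (fun t => -innerSL ℝ z (opA a b d (Ψ t) + G t)) T := by
    refine ⟨hzi.neg, fun t ht => ?_⟩
    have ht0 : IntervalIntegrable (fun t => innerSL ℝ z (opA a b d (Ψ t) + G t)) volume 0 t :=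
      hzi.mono_set (by
        rw [uIcc_of_le hT.le, uIcc_of_le ht.1]; exact Icc_subset_Icc_right ht.2)
    rw [e t ht, e 0 ⟨le_rfl, hT.le⟩, intervalIntegral.integral_neg,
      ← intervalIntegral.integral_interval_sub_left hzi ht0]
    ring
  refine ⟨hp.congr hT.le (fun _ _ => rfl) (ae_Ioc_of_volT ?_), by
    rw [e T ⟨hT.le, le_rfl⟩, intervalIntegral.integral_same]⟩
  filter_upwards [hΦ.ae_eq] with t ht
  rw [innerSL_apply_apply, inner_add_right, real_inner_comm (opA a b d (Ψ t)), inner_opA_Z h hm, ht]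
  ring

/-- The boundary term of the transposition identity, expanded in eigenvectors: `dx0 Ψ` is the
inner product of `-𝓐 Ψ` with the Dirichlet lift. -/
lemma IsBackwardSolution.hasSum_dx0 (h : 0 < a / d) (hβ : b / d < 1) (hμ : IsFreqSeq a b d μ)
    (hT : 0 < T) {G : ℝ → H a d} {Φ : ℝ → H1 a d} {Ψ : ℝ → H2 a d}
    (hΦ : IsBackwardSolution a b d T G Φ Ψ) {f : ℝ → ℝ} (hf : MemLp f 2 (volT T)) :
    HasSum (fun n => μ n / normY a d (μ n) *
        ∫ t in (0 : ℝ)..T, inner ℝ (toH a d (Φ t)) (toH a d (Z a d (μ n))) * f t)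
      (∫ t in (0 : ℝ)..T, dx0 (Ψ t) * f t) := by
  obtain ⟨B, hB⟩ := exists_basis h hβ hμ
  have hA := memLp_opA (b := b) h hΦ.memLp
  have hi : Integrable (fun t => f t • opA a b d (Ψ t)) (volT T) :=
    memLp_one_iff_integrable.1 (hA.smul hf)
  set W := ∫ t, f t • opA a b d (Ψ t) ∂(volT T) with hW
  have hWi : ∀ v : H a d, inner ℝ W v = ∫ t, f t * inner ℝ (opA a b d (Ψ t)) v ∂(volT T) := by
    intro v
    rw [real_inner_comm, hW, ← integral_inner hi]
    exact integral_congr_ae (.of_forall fun t => by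
      simp only [real_inner_smul_right, real_inner_comm v])
  have hs := (B.hasSum_inner_mul_inner W (lift a b d)).neg
  have e1 : -inner ℝ W (lift a b d) = ∫ t in (0 : ℝ)..T, dx0 (Ψ t) * f t := by
    rw [hWi, intervalIntegral_eq_volT hT.le, ← integral_neg]
    exact integral_congr_ae (.of_forall fun t => by
      simp only [inner_opA_lift h hβ]; ring)
  have e2 : ∀ n, -(inner ℝ W (B n) * inner ℝ (B n) (lift a b d)) = μ n / normY a d (μ n) *
        ∫ t in (0 : ℝ)..T, inner ℝ (toH a d (Φ t)) (toH a d (Z a d (μ n))) * f t := fun n => by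
    have hn := (hμ.pos n).ne'
    have e3 : inner ℝ W (B n) = -μ n ^ 2 *
        ∫ t in (0 : ℝ)..T, inner ℝ (toH a d (Φ t)) (toH a d (Z a d (μ n))) * f t := by
      rw [hWi, intervalIntegral_eq_volT hT.le, ← integral_const_mul]
      refine integral_congr_ae ?_
      filter_upwards [hΦ.ae_eq] with t ht
      rw [hB, inner_opA_Z h (hμ.isFreq n), ht]
      ring
    rw [e3, hB, real_inner_comm, inner_lift_Z h hβ (hμ.isFreq n)]
    field_simp
  rw [e1] at hs
  simpa only [e2] using hs

/-- The control system has a transposition solution for every initial datum in `𝓗` and every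
control in `L²(0,T)`. -/
lemma exists_isTranspositionSolution (h : 0 < a / d) (hβ : b / d < 1) (hμ : IsFreqSeq a b d μ)
    (hT : 0 < T) (U₀ : Hminus1 a d) {f : ℝ → ℝ} (hf : MemLp f 2 (volT T)) :
    ∃ U, IsTranspositionSolution a b d T U₀ f U := by
  obtain ⟨B, hB⟩ := exists_energyBasis h hβ hμ
  obtain ⟨C, hC⟩ := exists_basis h hβ hμ
  obtain ⟨w, hw⟩ := riesz_surjective hβ U₀
  have hfi := intervalIntegrable_of_memLp hT.le hf
  have hf2 : IntervalIntegrable (fun s => f s ^ 2) volume 0 T :=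
    (intervalIntegrable_iff_volT hT.le).2 hf.integrable_sq
  set F := ∫ t in (0 : ℝ)..T, f t ^ 2 with hF
  set c : ℕ → ℝ → ℝ := fun n => coeff a d (μ n) U₀ f with hc
  have hcp : ∀ n, IsPrimitive (c n) _ T := fun n => isPrimitive_duhamel hT.le hfi
  have hcc : ∀ n, ContinuousOn (c n) (Icc 0 T) := fun n => (hcp n).continuousOn hT.le
  -- The squares of the Fourier coefficients of `U₀` in the energy basis and of the Dirichlet lift
  -- in `H` are summable; by the energy estimate they control everything below.
  set u : ℕ → ℝ := fun n => inner ℝ (B n) w ^ 2 + inner ℝ (C n) (lift a b d) ^ 2 * F with hu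
  have hus : Summable u := by
    refine Summable.add ?_ (Summable.mul_right F ?_)
    · simpa only [sq, real_inner_comm w] using B.summable_inner_mul_inner w w
    · simpa only [sq, real_inner_comm (lift a b d)] using
        C.summable_inner_mul_inner (lift a b d) (lift a b d)
  have hη : ∀ n, inner ℝ (B n) w = U₀ (Z a d (μ n)) / μ n := fun n => by
    rw [hB, ← hw, riesz_apply, real_inner_smul_left, real_inner_comm, inv_mul_eq_div]
  have hκ : ∀ n, inner ℝ (C n) (lift a b d) = μ n / normY a d (μ n) / μ n ^ 2 := fun n => by
    rw [hC, real_inner_comm, inner_lift_Z h hβ (hμ.isFreq n)]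
  have hen : ∀ n, ∀ t ∈ Icc 0 T, c n t ^ 2 + μ n ^ 2 * ∫ s in (0 : ℝ)..t, c n s ^ 2 ≤
      μ n ^ 2 * u n := by
    intro n t ht
    have hn := hμ.pos n
    have hsub : uIcc 0 t ⊆ uIcc 0 T := by
      rw [uIcc_of_le ht.1, uIcc_of_le hT.le]; exact Icc_subset_Icc_right ht.2
    refine (duhamel_energy (by positivity) ht.1 (hfi.mono_set hsub) (hf2.mono_set hsub)).trans ?_
    have hFt : ∫ s in (0 : ℝ)..t, f s ^ 2 ≤ F :=
      intervalIntegral.integral_mono_interval le_rfl ht.1 ht.2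
        (.of_forall fun s => sq_nonneg _) hf2
    have e1 : μ n ^ 2 * u n = U₀ (Z a d (μ n)) ^ 2 +
        (μ n / normY a d (μ n)) ^ 2 / μ n ^ 2 * F := by
      simp only [hu, hη, hκ]
      field_simp
    rw [e1]
    gcongr
  have hcn : ∀ n, ∀ t ∈ Icc 0 T, 0 ≤ ∫ s in (0 : ℝ)..t, c n s ^ 2 := fun n t ht =>
    intervalIntegral.integral_nonneg ht.1 fun s _ => sq_nonneg _
  have hb1 : ∀ n, ∀ t ∈ Icc 0 T, (c n t / μ n) ^ 2 ≤ u n := by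
    intro n t ht
    have hn := hμ.pos n
    rw [div_pow, div_le_iff₀ (by positivity), mul_comm]
    exact (le_add_of_nonneg_right (mul_nonneg (sq_nonneg _) (hcn n t ht))).trans (hen n t ht)
  have hTm : T ∈ Icc 0 T := right_mem_Icc.2 hT.le
  have hb2 : ∀ n, ∫ s in (0 : ℝ)..T, c n s ^ 2 ≤ u n := by
    intro n
    have hn := hμ.pos n
    have := hen n T hTm
    exact le_of_mul_le_mul_left (by linarith [sq_nonneg (c n T)]) (by positivity : 0 < μ n ^ 2)
  -- The solution as a curve in `𝓗`, through the Riesz isomorphism.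
  have hx : ∀ t ∈ Icc 0 T, ∃ x : L2, ∀ n, inner ℝ (B n) x = c n t / μ n := fun t ht =>
    exists_repr_eq B (hus.of_nonneg_of_le (fun n => sq_nonneg _) fun n => hb1 n t ht)
  choose! x hx using hx
  have hxc : ContinuousOn x (Icc 0 T) :=
    continuousOn_of_coeff B hus
      (fun n => ((hcc n).div_const (μ n)).congr fun t ht => hx t ht n)
      (fun n t ht => by rw [hx t ht]; exact hb1 n t ht)
  have hUZ : ∀ t ∈ Icc 0 T, ∀ n, riesz a d hβ (x t) (Z a d (μ n)) = c n t := by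
    intro t ht n
    have h1 := hx t ht n
    have hn := (hμ.pos n).ne'
    rw [hB, real_inner_smul_left, real_inner_comm] at h1
    rw [riesz_apply]
    field_simp at h1
    exact h1
  -- The solution as an element of `L²(0,T;H)`.
  obtain ⟨V, hV, hVZ, hVG⟩ := exists_timeSeries (T := T) (hμ.orthonormal h hβ)
    (fun n => memLp_of_continuousOn (hcc n))
    (hus.of_nonneg_of_le (fun n => integral_nonneg fun t => sq_nonneg _) fun n => by
      rw [← intervalIntegral_eq_volT hT.le]; exact hb2 n)
  refine ⟨fun t => riesz a d hβ (x t), (riesz a d hβ).continuous.comp_continuousOn hxc, V, hV, ?_,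
    fun G Φ Ψ hG hΦ => ?_⟩
  · filter_upwards [ae_all_iff.2 hVZ, ae_restrict_mem measurableSet_Ioo] with t h1 h2
    rw [← sub_eq_zero]
    refine eq_zero_of_forall_Z h hβ hμ fun n => ?_
    rw [_root_.sub_apply, hUZ t (Ioo_subset_Icc_self h2), pivot_apply, h1, sub_self]
  · have s1 := hVG G hG
    have s2 := (hasSum_expansion h hβ hμ U₀).mapL
      (ContinuousLinearMap.apply ℝ ℝ (Φ 0))
    have s3 := s2.add (hΦ.hasSum_dx0 h hβ hμ hT hf)
    rw [intervalIntegral_eq_volT hT.le]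
    refine (s1.unique ?_)
    have e : ∀ n, ∫ t, c n t * inner ℝ (toH a d (Z a d (μ n))) (G t) ∂(volT T) =
        ContinuousLinearMap.apply ℝ ℝ (Φ 0) (U₀ (Z a d (μ n)) •
          pivot a d (toH a d (Z a d (μ n)))) + μ n / normY a d (μ n) *
        ∫ t in (0 : ℝ)..T, inner ℝ (toH a d (Φ t)) (toH a d (Z a d (μ n))) * f t := fun n => by
      obtain ⟨p1, p2⟩ := hΦ.isPrimitive h hT (hμ.isFreq n) hG
      have hgi : IntervalIntegrable (fun t => inner ℝ (toH a d (Z a d (μ n))) (G t)) volume 0 T :=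
        intervalIntegrable_of_memLp hT.le (hG.const_inner _)
      rw [← intervalIntegral_eq_volT hT.le, hc]
      simp only [coeff]
      rw [duhamel_duality hT.le hfi hgi p1 p2]
      simp only [ContinuousLinearMap.apply_apply, _root_.smul_apply, pivot_apply,
        smul_eq_mul, real_inner_comm (toH a d (Φ 0))]
    simp only [e]
    exact s3

/-! ### The moment problem -/

/-- Reversing time turns `c(T) = 0` into a moment equation for `θ(t) = f(T - t)`. -/
lemma coeff_eq_zero_iff {m : ℝ} (hm : m ≠ 0) (hN : normY a d m ≠ 0) {U₀ : Hminus1 a d}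
    {f θ : ℝ → ℝ} (hθ : ∀ t, θ t = f (T - t)) :
    coeff a d m U₀ f T = 0 ↔ ∫ t in (0 : ℝ)..T, θ t * Real.exp (-(m ^ 2) * t) =
      -(U₀ (Z a d m) * Real.exp (-(m ^ 2) * T) * normY a d m / m) := by
  have e : ∫ t in (0 : ℝ)..T, θ t * Real.exp (-(m ^ 2) * t) =
      Real.exp (-(m ^ 2) * T) * ∫ s in (0 : ℝ)..T, Real.exp (m ^ 2 * s) * f s := by
    have h1 := intervalIntegral.integral_comp_sub_left
      (fun s => Real.exp (-(m ^ 2) * T) * (Real.exp (m ^ 2 * s) * f s)) (a := 0) (b := T) T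
    rw [sub_self, sub_zero] at h1
    rw [← intervalIntegral.integral_const_mul, ← h1]
    refine intervalIntegral.integral_congr fun t _ => ?_
    simp only [hθ]
    rw [← mul_assoc, ← Real.exp_add, mul_comm]
    congr 2; ring
  rw [coeff, duhamel_eq_zero_iff, e]
  have hE := (Real.exp_pos (-(m ^ 2) * T)).ne'
  set J := ∫ s in (0 : ℝ)..T, Real.exp (m ^ 2 * s) * f s
  constructor
  · intro h1
    have : U₀ (Z a d m) = -(m / normY a d m * J) := by linarith
    rw [this]; field_simp
  · intro h1
    have h2 : Real.exp (-(m ^ 2) * T) * (m / normY a d m * J + U₀ (Z a d m)) = 0 := by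
      have : Real.exp (-(m ^ 2) * T) * (m / normY a d m * J + U₀ (Z a d m)) =
        m / normY a d m * (Real.exp (-(m ^ 2) * T) * J) +
          Real.exp (-(m ^ 2) * T) * U₀ (Z a d m) := by ring
      rw [this, h1]; field_simp; ring
    linarith [(mul_eq_zero.1 h2).resolve_left hE]

lemma memLp_comp_sub {f : ℝ → ℝ} (hf : MemLp f 2 (volT T)) :
    MemLp (fun t => f (T - t)) 2 (volT T) := by
  have hmp : MeasurePreserving (fun t : ℝ => T - t) (volT T) (volT T) := by
    have h := (Measure.measurePreserving_sub_left (volume : Measure ℝ) T).restrict_preimage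
      (s := Ioo 0 T) measurableSet_Ioo
    have e : (fun t : ℝ => T - t) ⁻¹' Ioo 0 T = Ioo 0 T := by
      simp
    rwa [e] at h
  exact hf.comp_measurePreserving hmp

lemma nullControllable_iff (h : 0 < a / d) (hβ : b / d < 1) (hμ : IsFreqSeq a b d μ)
    (hT : 0 < T) : NullControllable a b d T ↔
      ∀ U₀ : Hminus1 a d, ∃ θ : ℝ → ℝ, MemLp θ 2 (volT T) ∧
        ∀ n, ∫ t in (0 : ℝ)..T, θ t * Real.exp (-(μ n ^ 2) * t) =
          -(U₀ (Z a d (μ n)) * Real.exp (-(μ n ^ 2) * T) * normY a d (μ n) / μ n) := by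
  have hN : ∀ n, normY a d (μ n) ≠ 0 := fun n => (normY_pos h hβ (hμ.isFreq n)).ne'
  refine forall_congr' fun U₀ => ⟨?_, ?_⟩
  · rintro ⟨f, hf, U, hU, hUT⟩
    refine ⟨fun t => f (T - t), memLp_comp_sub hf, fun n => ?_⟩
    rw [← coeff_eq_zero_iff (hμ.pos n).ne' (hN n) fun _ => rfl,
      ← hU.apply_Z h hT (hμ.isFreq n) hf, hUT]
    rfl
  · rintro ⟨θ, hθ, hmom⟩
    have hf := memLp_comp_sub hθ
    obtain ⟨U, hU⟩ := exists_isTranspositionSolution h hβ hμ hT U₀ hf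
    refine ⟨_, hf, U, hU, eq_zero_of_forall_Z h hβ hμ fun n => ?_⟩
    rw [hU.apply_Z h hT (hμ.isFreq n) hf]
    exact (coeff_eq_zero_iff (hμ.pos n).ne' (hN n) fun t => by rw [sub_sub_cancel]).2 (hmom n)

end

end Wentzell

end

theorem mainTheorem2 (a b d : ℝ) (had : 0 < a * d) (hbd : b / d < 1) :
    ∃ μ : ℕ → ℝ,
      -- the numbers `μ n ^ 2` are the eigenvalues in increasing order, with eigenfunctions
      -- `sin (μ n x)`
      (∀ n, 0 < μ n) ∧ StrictMono μ ∧
      (∀ lam : ℝ, Wentzell.IsEigenvalue a b d lam ↔ ∃ n, lam = μ n ^ 2) ∧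
      (∀ n, Wentzell.IsEigenfunction a b d (μ n ^ 2) (fun x => Real.sin (μ n * x))) ∧
      -- the Fourier expansion of every element of the state space
      (∀ U₀ : Wentzell.Hminus1 a d,
        HasSum (fun n => U₀ (Wentzell.Z a d (μ n)) •
          Wentzell.pivot a d (Wentzell.toH a d (Wentzell.Z a d (μ n)))) U₀) ∧
      -- null controllability is equivalent to the solvability of the moment problem
      ∀ T : ℝ, 0 < T →
        (Wentzell.NullControllable a b d T ↔
          ∀ U₀ : Wentzell.Hminus1 a d,
            ∃ θ : ℝ → ℝ, MeasureTheory.MemLp θ 2 (Wentzell.volT T) ∧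
              ∀ n, ∫ t in (0 : ℝ)..T, θ t * Real.exp (-(μ n ^ 2) * t) =
                -(U₀ (Wentzell.Z a d (μ n)) * Real.exp (-(μ n ^ 2) * T) *
                  Wentzell.normY a d (μ n) / μ n)) := by
  have h : 0 < a / d := by
    rw [← mul_div_mul_right a d (right_ne_zero_of_mul had.ne')]
    exact div_pos had (mul_self_pos.2 (right_ne_zero_of_mul had.ne'))
  obtain ⟨μ, hμ⟩ := Wentzell.exists_isFreqSeq h hbd
  refine ⟨μ, hμ.pos, hμ.strictMono, fun lam => ?_, fun n => (hμ.isFreq n).isEigenfunction,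
    Wentzell.hasSum_expansion h hbd hμ, fun T hT => Wentzell.nullControllable_iff h hbd hμ hT⟩
  rw [Wentzell.isEigenvalue_iff h hbd]
  constructor
  · rintro ⟨m, hm, rfl⟩
    obtain ⟨n, rfl⟩ := (hμ.iff m).1 hm
    exact ⟨n, rfl⟩
  · rintro ⟨n, rfl⟩
    exact ⟨μ n, hμ.isFreq n, rfl⟩
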